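/- Let $M$ be a smooth regular closed curve in $\mathbb R^2$, parametrized by an immersion $f:S^1\to\mathbb R^2$. An inflexion point of a parametrized curve is a point with non-zero velocity at which the signed curvature changes sign. Assume that $M$ is generic in the following sense: every point of vanishing curvature is an ordinary inflexion point (the tangent line has contact of order exactly $2$), the tangent lines at two different inflexion points are never parallel, and the two tangent lines at a self-intersection point are different. A parallel pair is a pair of points $a\neq b$ of $M$ with parallel tangent lines (at a self-intersection point a choice of the branch of $M$ is part of the datum); its chord is the whole line $l(a,b)=\{\lambda a+(1-\lambda)b:\lambda\in\mathbb R\}$. For $\lambda\in\mathbb R$ let $E_\lambda(M)$ be the closure of the set of all points $\lambda a+(1-\lambda)b$ with $a,b$ a parallel pair. The smooth branches of $E_\lambda(M)$ are the images, under $(s,t)\mapsto\lambda f(s)+(1-\lambda)f(t)$, of smooth curves in the closure of the set of parameter pairs $(s,t)\in S^1\times S^1$ of parallel pairs, where for $\lambda=\frac12$ the pairs $(s,t)$ and $(t,s)$ are identified. The inflexion points of $E_\lambda(M)$ are the inflexion points of its smooth branches; they are counted on the branches, so a point of the plane at which several branches (or one branch several times) have an inflexion is counted once for each. Let $\varphi_M:S^1\to\mathbb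 R/\pi\mathbb Z$ be the angle function of $M$, i.e. $\varphi_M(s)$ is the oriented angle between $f'(0)$ and $f'(s)$ modulo $\pi$. A value $\varphi_M(s)$ with $\varphi_M'(s)=0$ and $\varphi_M''(s)\ne0$ is called a local extremum of $\varphi_M$. Suppose that $M$ has exactly $2n>0$ inflexion points and that the sequence of parallel points, i.e. the set of all $s\in S^1$ such that $\varphi_M(s)$ is a local extremum of $\varphi_M$, has exactly $2m$ elements. Then (i) $E_{1/2}(M)$ has exactly $2m-2n$ inflexion points; (ii) $E_\lambda(M)$ has exactly $4m-2n$ inflexion points for every real $\lambda\neq0,\frac12,1$; (iii) the set of all inflexion points of all $E_\lambda(M)$, $\lambda\in\mathbb R$, is the union, over all parallel pairs $a,b$ such that $a$ is an inflexion point of $M$, of the chords $l(a,b)$ with the point $b$ removed. If moreover, for each fixed $\lambda\ne0,1$, the points $\lambda a+(1-\lambda)b$ given by the different ordered pairs $(a,b)$ which are either a parallel pair containing an inflexion point of $M$ or of the form $(a,a)$ with $a$ an inflexion point of $M$ are different (apart from the equality for $(a,b)$ and $(b,a)$ when $\lambda=\frac12$), then the numbers in (i) and (ii) are also the numbers of points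 of the plane that are inflexion points of $E_{1/2}(M)$ and $E_\lambda(M)$. -/

import Mathlib

open Set Filter Topology Function
open scoped ContDiff

noncomputable section

/-! The Euclidean plane is identified with `ℂ`.  A closed curve is a `1`-periodic map on `ℝ`;
points of the circle of parameters are represented by `Set.Ico 0 1`. -/

/-- The determinant of two plane vectors. -/
def planeDet (u v : ℂ) : ℝ := u.re * v.im - u.im * v.re

/-- The signed curvature of a parametrized plane curve (meaningful where the velocity is nonzero). -/
def signedCurvature (g : ℝ → ℂ) (t : ℝ) : ℝ :=
  planeDet (deriv g t) (deriv (deriv g) t) / ‖deriv g t‖ ^ 3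

/-- The parametrized curve `g` has an inflexion at the parameter `t`: its velocity at `t` is nonzero
and its signed curvature changes sign at `t`. -/
def HasInflexionAt (g : ℝ → ℂ) (t : ℝ) : Prop :=
  deriv g t ≠ 0 ∧
    (((∀ᶠ u in 𝓝[<] t, signedCurvature g u < 0) ∧ (∀ᶠ u in 𝓝[>] t, 0 < signedCurvature g u)) ∨
     ((∀ᶠ u in 𝓝[<] t, 0 < signedCurvature g u) ∧ (∀ᶠ u in 𝓝[>] t, signedCurvature g u < 0)))

/-- Smooth regular closed curves, parametrized by the circle `ℝ / ℤ`. -/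
structure IsRegularClosedCurve (f : ℝ → ℂ) : Prop where
  smooth : ContDiff ℝ ∞ f
  periodic : Function.Periodic f 1
  regular : ∀ s, deriv f s ≠ 0

/-- The parameters, in the circle, of the inflexion points of the closed curve `f`. -/
def inflexionParams (f : ℝ → ℂ) : Set ℝ := {s | s ∈ Ico (0 : ℝ) 1 ∧ HasInflexionAt f s}

/-- Genericity of a regular closed curve: points of vanishing curvature are ordinary inflexions
(contact of order exactly two with the tangent line), tangent lines at different inflexions are not
parallel, and the two tangent lines at a self-intersection are different. -/
structure IsGenericCurve (f : ℝ → ℂ) : Prop where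
  ordinary : ∀ s, planeDet (deriv f s) (iteratedDeriv 2 f s) = 0 →
    planeDet (deriv f s) (iteratedDeriv 3 f s) ≠ 0
  inflexions_not_parallel : ∀ s ∈ inflexionParams f, ∀ t ∈ inflexionParams f, s ≠ t →
    planeDet (deriv f s) (deriv f t) ≠ 0
  transverse_crossings : ∀ s ∈ Ico (0 : ℝ) 1, ∀ t ∈ Ico (0 : ℝ) 1, s ≠ t → f s = f t →
    planeDet (deriv f s) (deriv f t) ≠ 0

/-! ### The angle function and the sequence of parallel points -/

/-- The angle function: the oriented angle from the velocity at `0` to the velocity at `s`,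
modulo `π`. -/
def angleFunction (f : ℝ → ℂ) (s : ℝ) : AddCircle Real.pi :=
  ((Complex.arg (deriv f s) - Complex.arg (deriv f 0) : ℝ) : AddCircle Real.pi)

/-- The angle function has first derivative zero and nonzero second derivative at `s`.
Derivatives of the circle-valued angle function are those of a local real-valued lift. -/
def AngleExtremumAt (f : ℝ → ℂ) (s : ℝ) : Prop :=
  ∃ θ : ℝ → ℝ, ContDiffAt ℝ 2 θ s ∧
    (∀ᶠ u in 𝓝 s, ((θ u : ℝ) : AddCircle Real.pi) = angleFunction f u) ∧
    deriv θ s = 0 ∧ deriv (deriv θ) s ≠ 0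

/-- The set of local extrema (as values) of the angle function. -/
def angleExtrema (f : ℝ → ℂ) : Set (AddCircle Real.pi) :=
  {c | ∃ s, angleFunction f s = c ∧ AngleExtremumAt f s}

open Classical in
/-- The underlying set of the sequence of parallel points: the parameters in the circle at which
the angle function takes one of its extremal values, or, if there are none, its value at `0`. -/
def parallelPoints (f : ℝ → ℂ) : Set ℝ :=
  if (angleExtrema f).Nonempty then {s | s ∈ Ico (0 : ℝ) 1 ∧ angleFunction f s ∈ angleExtrema f}
  else {s | s ∈ Ico (0 : ℝ) 1 ∧ angleFunction f s = angleFunction f 0}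

/-! ### Parallel pairs, chords and equidistants -/

/-- The points with parameters `s`, `t` form a parallel pair: they are different and the tangent
lines there are parallel. -/
def IsParallelPair (f : ℝ → ℂ) (s t : ℝ) : Prop :=
  f s ≠ f t ∧ planeDet (deriv f s) (deriv f t) = 0

/-- The chord through `a` and `b` is the whole line through these points. -/
def chord (a b : ℂ) : Set ℂ := {p | ∃ r : ℝ, p = (r : ℂ) * a + ((1 - r : ℝ) : ℂ) * b}

/-- The `lam`-point map composed with the parametrization. -/
def pointMap (f : ℝ → ℂ) (lam : ℝ) (x : ℝ × ℝ) : ℂ :=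
  (lam : ℂ) * f x.1 + ((1 - lam : ℝ) : ℂ) * f x.2

/-- The affine `lam`-equidistant. -/
def equidistant (f : ℝ → ℂ) (lam : ℝ) : Set ℂ :=
  closure {p | ∃ s t, IsParallelPair f s t ∧ p = pointMap f lam (s, t)}

/-- The closure of the set of (parameters of) parallel pairs.  The smooth branches of the
equidistants are the images, under the point map, of smooth curves in this set. -/
def closedParallelPairs (f : ℝ → ℂ) : Set (ℝ × ℝ) :=
  closure {x | IsParallelPair f x.1 x.2}

/-- A smooth branch of the `lam`-equidistant has an inflexion at the point with pair of
parameters `x`: there is a smooth arc `c` of (limits of) parallel pairs through `x` such that the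
arc of the equidistant given by `pointMap f lam ∘ c` has an inflexion at `x`. -/
def BranchInflexionAt (f : ℝ → ℂ) (lam : ℝ) (x : ℝ × ℝ) : Prop :=
  ∃ (ε : ℝ) (c : ℝ → ℝ × ℝ), 0 < ε ∧ ContDiffOn ℝ ∞ c (Ioo (-ε) ε) ∧ c 0 = x ∧
    (∀ τ ∈ Ioo (-ε) ε, c τ ∈ closedParallelPairs f) ∧
    HasInflexionAt (fun τ => pointMap f lam (c τ)) 0

/-- The inflexion points of the `lam`-equidistant, as points of the plane. -/
def inflexionPoints (f : ℝ → ℂ) (lam : ℝ) : Set ℂ :=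
  {p | p ∈ equidistant f lam ∧ ∃ x : ℝ × ℝ, BranchInflexionAt f lam x ∧ p = pointMap f lam x}

/-- The inflexions of the smooth branches of the `lam`-equidistant, as ordered pairs of parameters
in the circle. This is the set of inflexions on the branches if `lam ≠ 1/2`. -/
def branchInflexions (f : ℝ → ℂ) (lam : ℝ) : Set (ℝ × ℝ) :=
  {x | x.1 ∈ Ico (0 : ℝ) 1 ∧ x.2 ∈ Ico (0 : ℝ) 1 ∧ BranchInflexionAt f lam x}

/-- The inflexions of the smooth branches of the Wigner caustic, as unordered pairs of parameters
in the circle: for `lam = 1/2` the pairs `(s, t)` and `(t, s)` are the same point of a branch. -/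
def wignerBranchInflexions (f : ℝ → ℂ) : Set (Sym2 ℝ) :=
  (fun x : ℝ × ℝ => s(x.1, x.2)) '' branchInflexions f (1 / 2)

/-- A pair of parameters in the circle, possibly equal, with parallel tangent lines, at least one
of them being the parameter of an inflexion point of the curve. -/
def IsInflexionPair (f : ℝ → ℂ) (x : ℝ × ℝ) : Prop :=
  x.1 ∈ Ico (0 : ℝ) 1 ∧ x.2 ∈ Ico (0 : ℝ) 1 ∧ planeDet (deriv f x.1) (deriv f x.2) = 0 ∧
    (x.1 ∈ inflexionParams f ∨ x.2 ∈ inflexionParams f)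

/-- The chords of the pairs containing an inflexion point are in general position: points dividing
different ordered pairs in the same ratio are different, apart from the equality
`a / 2 + b / 2 = b / 2 + a / 2`. -/
def ChordsInGeneralPosition (f : ℝ → ℂ) : Prop :=
  ∀ lam : ℝ, lam ≠ 0 → lam ≠ 1 → ∀ x y : ℝ × ℝ, IsInflexionPair f x → IsInflexionPair f y →
    pointMap f lam x = pointMap f lam y → x = y ∨ (lam = 1 / 2 ∧ x = y.swap)

end

noncomputable section

/-! ### Hadamard's lemma and the Morse lemma on the line -/

/-! Write `f' = exp L` with `L` smooth and let `θ = Im L`. Tangents at `s`, `t` are parallel iff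
`sin (θ t - θ s) = 0`. The curvature is `θ' / |f'|`, and genericity makes every zero of `θ'` simple,
so inflexions are exactly these zeros.

Along a smooth arc `(s, t)` of parallel pairs the image in the equidistant has velocity `ρ f'(s)`,
where `ρ = λ s' + (1 - λ) r t'` is real and `r = f'(t) / f'(s)`. The determinant of its first two
derivatives is `|f'(s)|² ρ² θ'(s) s'`. Hence there is an inflexion iff `ρ ≠ 0` and `θ'(s) s'`
changes sign (`hasInflexionAt_pointMap_iff`). Differentiating the parallelism relation gives `θ'(t)
t' = θ'(s) s'`, so at an inflexion one of the two points must be an inflexion of the curve, as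
otherwise `s' = t' = 0` and `ρ = 0`.

If only `s` is an inflexion, then `t' = 0` and `ρ = λ s'`: there is an inflexion exactly when `λ ≠
0`, and symmetrically `λ ≠ 1` for `t`. If both are, they are the same point of the curve. The branch
there is the graph of the Morse involution exchanging points of equal angle, whose derivative `-1`
gives `ρ = 2λ - 1`: an inflexion exactly when `λ ≠ 1/2`. This is `branchInflexionAt_iff`.

For the count, a parallel point that is not an inflexion is parallel to exactly one inflexion, so
there are `2m - 2n` mixed pairs (`ncard_properInflexionPairs`). The Wigner caustic sees them
unordered; another equidistant sees both orders and the `2n` diagonal pairs, in total `2(2m - 2n) +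
2n`. Letting `λ` vary over a mixed pair sweeps its chord without the point `λ = 0`. -/

theorem hasDerivAt_integral_mul_comp_mul {p φ : ℝ → ℝ} (hp : Continuous p) (hφ : ContDiff ℝ 1 φ)
    (x : ℝ) :
    HasDerivAt (fun x => ∫ u in (0 : ℝ)..1, p u * φ (x * u))
      (∫ u in (0 : ℝ)..1, (p u * u) * deriv φ (x * u)) x := by
  have hφ' : Continuous (deriv φ) := hφ.continuous_deriv le_rfl
  have hφc : Continuous φ := hφ.continuous
  have hc : Continuous (fun z : ℝ × ℝ => (p z.2 * z.2) * deriv φ (z.1 * z.2)) := by fun_prop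
  obtain ⟨C, hC⟩ := ((isCompact_Icc (a := x - 1) (b := x + 1)).prod
    (isCompact_Icc (a := (0 : ℝ)) (b := 1))).exists_bound_of_continuousOn hc.continuousOn
  refine (intervalIntegral.hasDerivAt_integral_of_dominated_loc_of_deriv_le
    (F := fun x u => p u * φ (x * u)) (F' := fun x u => (p u * u) * deriv φ (x * u))
    (bound := fun _ => C) (Icc_mem_nhds (sub_one_lt x) (lt_add_one x)) ?_ ?_ ?_ ?_ ?_ ?_).2
  · exact .of_forall fun y => (by fun_prop : Continuous _).aestronglyMeasurable
  · exact (by fun_prop : Continuous _).intervalIntegrable _ _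
  · exact (by fun_prop : Continuous _).aestronglyMeasurable
  · refine .of_forall fun u hu y hy => hC (y, u) ⟨hy, ?_⟩
    rw [uIoc_of_le zero_le_one] at hu
    exact Ioc_subset_Icc_self hu
  · exact intervalIntegrable_const
  · refine .of_forall fun u _ y _ => ?_
    have h := ((hφ.differentiable one_ne_zero (y * u)).hasDerivAt.comp y
      ((hasDerivAt_id y).mul_const u)).const_mul (p u)
    refine h.congr_deriv ?_
    ring

/-- The weight `p` makes the induction close: differentiating under the integral gives an integral
of the same shape, with `p u * u` and `deriv φ`. -/
theorem contDiff_integral_mul_comp_mul (n : ℕ) : ∀ {p φ : ℝ → ℝ}, Continuous p → ContDiff ℝ ∞ φ →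
    ContDiff ℝ n (fun x => ∫ u in (0 : ℝ)..1, p u * φ (x * u)) := by
  induction n with
  | zero =>
    intro p φ hp hφ
    refine contDiff_zero.2 (continuous_iff_continuousAt.2 fun x => ?_)
    exact (hasDerivAt_integral_mul_comp_mul hp (hφ.of_le (by exact_mod_cast le_top)) x).continuousAt
  | succ n ih =>
    intro p φ hp hφ
    have hd := hasDerivAt_integral_mul_comp_mul hp (hφ.of_le (by exact_mod_cast le_top))
    push_cast
    refine contDiff_succ_iff_deriv.2 ⟨fun x => (hd x).differentiableAt, by simp, ?_⟩
    rw [funext fun x => (hd x).deriv]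
    exact ih (hp.mul continuous_id) (contDiff_infty_iff_deriv.1 hφ).2

/-- The quotient is the integral of `φ' (x u)` over `u ∈ [0, 1]`, which stays smooth at `x = 0`. -/
theorem exists_contDiff_eq_mul {φ : ℝ → ℝ} (hφ : ContDiff ℝ ∞ φ) (h0 : φ 0 = 0) :
    ∃ h : ℝ → ℝ, ContDiff ℝ ∞ h ∧ ∀ x, φ x = x * h x := by
  have hφ' := (contDiff_infty_iff_deriv.1 hφ).2
  refine ⟨fun x => ∫ u in (0 : ℝ)..1, 1 * deriv φ (x * u), contDiff_infty.2 fun n =>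
    contDiff_integral_mul_comp_mul n continuous_const hφ', fun x => ?_⟩
  have hd : ∀ u ∈ uIcc (0 : ℝ) 1, HasDerivAt (fun u => φ (x * u)) (x * (1 * deriv φ (x * u))) u := by
    intro u _
    have h := ((hφ.differentiable (by simp) (x * u)).hasDerivAt.comp u
      ((hasDerivAt_id u).const_mul x))
    refine h.congr_deriv ?_
    ring
  have := intervalIntegral.integral_eq_sub_of_hasDerivAt hd
    ((by have := hφ'.continuous; fun_prop : Continuous _).intervalIntegrable _ _)
  rw [intervalIntegral.integral_const_mul] at this
  simpa [h0] using this.symm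

/-- A smooth function with nonzero derivative at a point has a smooth local inverse. -/
theorem exists_smooth_local_inverse {w : ℝ → ℝ} {a d : ℝ} (hw : ∀ᶠ x in 𝓝 a, ContDiffAt ℝ ∞ w x)
    (hd : HasDerivAt w d a) (hd0 : d ≠ 0) :
    ∃ ψ : ℝ → ℝ, ψ (w a) = a ∧ ∀ᶠ y in 𝓝 (w a), ContDiffAt ℝ ∞ ψ y ∧ w (ψ y) = y := by
  have hwa := hw.self_of_nhds
  let e := hwa.toOpenPartialHomeomorph w
    (f' := ContinuousLinearEquiv.unitsEquivAut ℝ (Units.mk0 d hd0))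
    (hd.hasFDerivAt_equiv hd0) (by simp)
  have hea : a ∈ e.source := hwa.mem_toOpenPartialHomeomorph_source _ (by simp)
  have hew : (e : ℝ → ℝ) = w := rfl
  have hsymm : e.symm (w a) = a := e.left_inv hea
  refine ⟨e.symm, hsymm, ?_⟩
  have hta : w a ∈ e.target := e.map_source hea
  have hcont : Tendsto e.symm (𝓝 (w a)) (𝓝 a) := by
    have := e.symm.continuousAt (x := w a) hta
    rwa [ContinuousAt, hsymm] at this
  have hne : ∀ᶠ x in 𝓝 a, deriv w x ≠ 0 := by
    have : ContinuousAt (deriv w) a := by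
      exact (hwa.continuousAt_fderiv (by simp)).clm_apply continuousAt_const
    exact this.eventually_ne (by rwa [hd.deriv])
  filter_upwards [e.open_target.mem_nhds hta, hcont.eventually hw, hcont.eventually hne]
    with y hy hy1 hy2
  exact ⟨e.contDiffAt_symm_deriv hy2 hy (hy1.differentiableAt (by simp)).hasDerivAt hy1,
    e.right_inv hy⟩

/-- Near a nondegenerate critical point, the points of equal value are exchanged by a smooth
involution reversing the direction. -/
theorem exists_smooth_involution {θ : ℝ → ℝ} (hθ : ContDiff ℝ ∞ θ) {a : ℝ} (h1 : deriv θ a = 0)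
    (h2 : deriv (deriv θ) a ≠ 0) :
    ∃ σ : ℝ → ℝ, σ a = a ∧ HasDerivAt σ (-1) a ∧ (∀ᶠ x in 𝓝 a, ContDiffAt ℝ ∞ σ x) ∧
      (∀ᶠ x in 𝓝 a, θ (σ x) = θ x) ∧ ∀ᶠ x in 𝓝[≠] a, σ x ≠ x := by
  obtain ⟨g, hg, hg'⟩ := exists_contDiff_eq_mul (φ := fun x => θ (a + x) - θ a) (by fun_prop) (by simp)
  have hdθ : ∀ x, HasDerivAt θ (deriv θ x) x := fun x => (hθ.differentiable (by simp) x).hasDerivAt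
  have hdg : ∀ x, HasDerivAt g (deriv g x) x := fun x => (hg.differentiable (by simp) x).hasDerivAt
  have hg1 := (contDiff_infty_iff_deriv.1 hg).2
  have e1 : ∀ x, deriv θ (a + x) = g x + x * deriv g x := by
    intro x
    have A : HasDerivAt (fun x => θ (a + x) - θ a) (deriv θ (a + x)) x := by
      simpa using ((hdθ (a + x)).comp_const_add a x).sub_const (θ a)
    rw [funext hg'] at A
    have B := (hasDerivAt_id x).mul (hdg x)
    simpa using A.unique B
  have g0 : g 0 = 0 := by simpa [h1] using (e1 0).symm
  obtain ⟨h, hh, hh'⟩ := exists_contDiff_eq_mul hg g0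
  have e2 : deriv (deriv θ) a = 2 * h 0 := by
    have A : HasDerivAt (fun x => deriv θ (a + x)) (deriv (deriv θ) a) 0 := by
      have := (((contDiff_infty_iff_deriv.1 hθ).2.differentiable (by simp)) (a + 0)).hasDerivAt
      simpa using this.comp_const_add a 0
    rw [funext e1] at A
    have B := (hdg 0).add ((hasDerivAt_id (0 : ℝ)).mul ((hg1.differentiable (by simp) 0).hasDerivAt))
    have C := A.unique B
    have D : deriv g 0 = h 0 := by
      have E := hdg 0
      rw [funext hh'] at E
      have F := (hasDerivAt_id (0 : ℝ)).mul ((hh.differentiable (by simp) 0).hasDerivAt)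
      simpa [funext hh'] using E.unique F
    simp at C
    rw [C, D]; ring
  have h0 : h 0 ≠ 0 := fun H => h2 (by rw [e2, H, mul_zero])
  set c := SignType.sign (h 0) with hc
  have hq : ContDiff ℝ ∞ fun x => (c : ℝ) * h (x - a) := by fun_prop
  have hqa : 0 < (c : ℝ) * h (a - a) := by
    rw [sub_self, hc, sign_mul_self]; exact abs_pos.2 h0
  have hc0 : (c : ℝ) ≠ 0 := by intro H; simp [H] at hqa
  have hqpos : ∀ᶠ x in 𝓝 a, 0 < (c : ℝ) * h (x - a) :=
    hq.continuous.continuousAt.eventually (lt_mem_nhds hqa)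
  -- Two applications of Hadamard's lemma give `θ x - θ a = (x - a)² h (x - a)`. With `c` the sign
  -- of `h 0`, `w` is a local coordinate in which `θ - θ a` is `± w²`.
  set w : ℝ → ℝ := fun x => (x - a) * √((c : ℝ) * h (x - a)) with hw
  have hws : ∀ᶠ x in 𝓝 a, ContDiffAt ℝ ∞ w x := by
    filter_upwards [hqpos] with x hx
    exact (contDiffAt_id.sub contDiffAt_const).mul (hq.contDiffAt.sqrt hx.ne')
  have hwθ : ∀ᶠ x in 𝓝 a, w x ^ 2 = c * (θ x - θ a) := by
    filter_upwards [hqpos] with x hx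
    have := hg' (x - a)
    rw [hh' (x - a)] at this
    simp only [add_sub_cancel] at this
    rw [hw, mul_pow, Real.sq_sqrt hx.le, this]; ring
  have hwa : w a = 0 := by simp [hw]
  set d := √((c : ℝ) * h (a - a)) with hd
  have hd0 : d ≠ 0 := (Real.sqrt_pos.2 hqa).ne'
  have hwd : HasDerivAt w d a := by
    have := ((hasDerivAt_id a).sub_const a).mul
      ((hq.contDiffAt.sqrt hqa.ne' : ContDiffAt ℝ ∞ _ a).differentiableAt (by simp)).hasDerivAt
    exact this.congr_deriv (by simp [hd])
  obtain ⟨ψ, hψa, hψ⟩ := exists_smooth_local_inverse hws hwd hd0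
  rw [hwa] at hψa hψ
  have hψd : HasDerivAt ψ d⁻¹ 0 := by
    have h1 : HasDerivAt w d (ψ 0) := by rwa [hψa]
    exact h1.of_local_left_inverse (hψ.self_of_nhds.1.continuousAt) hd0 (hψ.mono fun y hy => hy.2)
  have hwneg : Tendsto (fun x => - w x) (𝓝 a) (𝓝 0) := by
    have := hws.self_of_nhds.continuousAt.tendsto.neg
    rwa [hwa, neg_zero] at this
  have hσ : Tendsto (fun x => ψ (- w x)) (𝓝 a) (𝓝 a) := by
    have := hψ.self_of_nhds.1.continuousAt.tendsto
    rw [hψa] at this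
    exact this.comp hwneg
  have hinv : ∀ᶠ x in 𝓝 a, w (ψ (- w x)) = - w x := (hwneg.eventually hψ).mono fun x hx => hx.2
  -- The involution is `w ↦ -w` read in the coordinate `w`, with `ψ` the local inverse of `w`.
  refine ⟨fun x => ψ (- w x), by simp [hwa, hψa], ?_, ?_, ?_, ?_⟩
  · have h1 : HasDerivAt ψ d⁻¹ (- w a) := by simpa [hwa] using hψd
    have := h1.comp a hwd.neg
    exact this.congr_deriv (by field_simp)
  · filter_upwards [hws, hwneg.eventually hψ] with x hx hx'
    exact hx'.1.comp x hx.neg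
  · filter_upwards [hwθ, hσ.eventually hwθ, hinv] with x hx hx' hx''
    rw [hx'', neg_sq, hx] at hx'
    have := mul_left_cancel₀ hc0 hx'
    linarith
  · filter_upwards [hwd.eventually_ne hd0 (c := 0), hinv.filter_mono nhdsWithin_le_nhds]
      with x hx hx' H
    rw [H] at hx'
    exact hx (by linarith)

/-! ### Changes of sign -/

/-- The real function `h` changes sign at `t`. -/
def ChangesSignAt (h : ℝ → ℝ) (t : ℝ) : Prop :=
  ((∀ᶠ u in 𝓝[<] t, h u < 0) ∧ (∀ᶠ u in 𝓝[>] t, 0 < h u)) ∨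
    ((∀ᶠ u in 𝓝[<] t, 0 < h u) ∧ (∀ᶠ u in 𝓝[>] t, h u < 0))

theorem ChangesSignAt.eq_zero {h : ℝ → ℝ} {t : ℝ} (H : ChangesSignAt h t) (hc : ContinuousAt h t) :
    h t = 0 := by
  have hl : Tendsto h (𝓝[<] t) (𝓝 (h t)) := hc.tendsto.mono_left nhdsWithin_le_nhds
  have hr : Tendsto h (𝓝[>] t) (𝓝 (h t)) := hc.tendsto.mono_left nhdsWithin_le_nhds
  rcases H with ⟨a, b⟩ | ⟨a, b⟩
  · exact le_antisymm (le_of_tendsto hl (a.mono fun _ h => h.le))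
      (ge_of_tendsto hr (b.mono fun _ h => h.le))
  · exact le_antisymm (le_of_tendsto hr (b.mono fun _ h => h.le))
      (ge_of_tendsto hl (a.mono fun _ h => h.le))

theorem HasDerivAt.changesSignAt {h : ℝ → ℝ} {d t : ℝ} (hd : HasDerivAt h d t) (h0 : h t = 0)
    (hd0 : d ≠ 0) : ChangesSignAt h t := by
  have hs := hasDerivAt_iff_tendsto_slope.1 hd
  have key : ∀ u, u ≠ t → h u = slope h t u * (u - t) := by
    intro u hu
    rw [slope_def_field, h0, sub_zero, div_mul_cancel₀ _ (sub_ne_zero.2 hu)]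
  have hl : Tendsto (slope h t) (𝓝[<] t) (𝓝 d) := hs.mono_left (nhdsWithin_mono _ fun x hx => ne_of_lt hx)
  have hr : Tendsto (slope h t) (𝓝[>] t) (𝓝 d) := hs.mono_left (nhdsWithin_mono _ fun x hx => ne_of_gt hx)
  rcases lt_or_gt_of_ne hd0 with hneg | hpos
  · right
    constructor
    · filter_upwards [hl.eventually (gt_mem_nhds hneg), self_mem_nhdsWithin] with u hu hut
      rw [key u (ne_of_lt hut)]
      exact mul_pos_of_neg_of_neg hu (sub_neg.2 hut)
    · filter_upwards [hr.eventually (gt_mem_nhds hneg), self_mem_nhdsWithin] with u hu hut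
      rw [key u (ne_of_gt hut)]
      exact mul_neg_of_neg_of_pos hu (sub_pos.2 hut)
  · left
    constructor
    · filter_upwards [hl.eventually (lt_mem_nhds hpos), self_mem_nhdsWithin] with u hu hut
      rw [key u (ne_of_lt hut)]
      exact mul_neg_of_pos_of_neg hu (sub_neg.2 hut)
    · filter_upwards [hr.eventually (lt_mem_nhds hpos), self_mem_nhdsWithin] with u hu hut
      rw [key u (ne_of_gt hut)]
      exact mul_pos hu (sub_pos.2 hut)

/-- The change of sign is not affected by a positive factor. -/
theorem changesSignAt_congr_mul_pos {h k q : ℝ → ℝ} {t : ℝ} (hq : ∀ᶠ u in 𝓝 t, 0 < q u)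
    (hk : ∀ᶠ u in 𝓝 t, k u = q u * h u) : ChangesSignAt k t ↔ ChangesSignAt h t := by
  have e : ∀ᶠ u in 𝓝 t, (k u < 0 ↔ h u < 0) ∧ (0 < k u ↔ 0 < h u) := by
    filter_upwards [hq, hk] with u hu hk
    rw [hk]
    exact ⟨by rw [mul_neg_iff]; constructor <;> [rintro (⟨_, h⟩ | ⟨h, _⟩) <;> linarith; exact fun h => .inl ⟨hu, h⟩],
      mul_pos_iff_of_pos_left hu⟩
  have el := e.filter_mono (nhdsWithin_le_nhds (s := Iio t))
  have er := e.filter_mono (nhdsWithin_le_nhds (s := Ioi t))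
  unfold ChangesSignAt
  rw [eventually_congr (el.mono fun u hu => hu.1), eventually_congr (er.mono fun u hu => hu.1),
    eventually_congr (el.mono fun u hu => hu.2), eventually_congr (er.mono fun u hu => hu.2)]

theorem hasInflexionAt_iff (g : ℝ → ℂ) (t : ℝ) :
    HasInflexionAt g t ↔ deriv g t ≠ 0 ∧ ChangesSignAt (signedCurvature g) t := Iff.rfl

/-! ### The logarithm of the velocity -/

/-- `L` is a smooth logarithm of the velocity of `f`; its imaginary part is an angle function. -/
structure IsLogVelocity (f : ℝ → ℂ) (L : ℝ → ℂ) : Prop where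
  smooth : ContDiff ℝ ∞ L
  exp_eq : ∀ s, deriv f s = Complex.exp (L s)

theorem IsRegularClosedCurve.exists_isLogVelocity {f : ℝ → ℂ} (hf : IsRegularClosedCurve f) :
    ∃ L, IsLogVelocity f L := by
  have h1 := (contDiff_infty_iff_deriv.1 hf.smooth).2
  have h2 := (contDiff_infty_iff_deriv.1 h1).2
  have hq : ContDiff ℝ ∞ fun s => deriv (deriv f) s / deriv f s := by
    simp only [div_eq_mul_inv]
    exact h2.mul (h1.inv hf.regular)
  -- Integrating the logarithmic derivative avoids choosing branches; `f' exp (-L)` is then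
  -- constant, equal to `1`.
  set L : ℝ → ℂ := fun s => Complex.log (deriv f 0) +
    ∫ u in (0 : ℝ)..s, deriv (deriv f) u / deriv f u with hL
  have hd : ∀ s, HasDerivAt L (deriv (deriv f) s / deriv f s) s := fun s =>
    (hq.continuous.integral_hasStrictDerivAt 0 s).hasDerivAt.const_add _
  refine ⟨L, contDiff_infty_iff_deriv.2 ⟨fun s => (hd s).differentiableAt, ?_⟩, fun s => ?_⟩
  · rwa [funext fun s => (hd s).deriv]
  have hc : ∀ s, HasDerivAt (fun s => deriv f s * Complex.exp (- L s)) 0 s := by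
    intro s
    have := (h1.differentiable (by simp) s).hasDerivAt.mul (hd s).neg.cexp
    refine this.congr_deriv ?_
    field_simp [hf.regular s]
    simp
  have := is_const_of_deriv_eq_zero (fun s => (hc s).differentiableAt) (fun s => (hc s).deriv) s 0
  simp only [hL, intervalIntegral.integral_same, add_zero, Complex.exp_neg,
    Complex.exp_log (hf.regular 0), mul_inv_cancel₀ (hf.regular 0)] at this
  exact (mul_inv_eq_one₀ (Complex.exp_ne_zero _)).1 this

theorem planeDet_exp (z w : ℂ) : planeDet (Complex.exp z) (Complex.exp w) =
    Real.exp z.re * Real.exp w.re * Real.sin (w.im - z.im) := by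
  simp only [planeDet, Complex.exp_re, Complex.exp_im, Real.sin_sub]; ring

theorem planeDet_mul_self (c u : ℂ) : planeDet u (c * u) = ‖u‖ ^ 2 * c.im := by
  rw [← Complex.normSq_eq_norm_sq, Complex.normSq_apply]
  simp only [planeDet, Complex.mul_re, Complex.mul_im]; ring

theorem planeDet_real_mul (a : ℝ) (u v : ℂ) : planeDet (a * u) v = a * planeDet u v := by
  simp only [planeDet, Complex.mul_re, Complex.mul_im, Complex.ofReal_re, Complex.ofReal_im]; ring

/-- The angle function given by a logarithm of the velocity. -/
def velocityAngle (L : ℝ → ℂ) (s : ℝ) : ℝ := (L s).im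

namespace IsLogVelocity

variable {f L : ℝ → ℂ} (h : IsLogVelocity f L)
include h

theorem contDiff_angle : ContDiff ℝ ∞ (velocityAngle L) := Complex.imCLM.contDiff.comp h.smooth

theorem contDiff_deriv_angle : ContDiff ℝ ∞ (deriv (velocityAngle L)) :=
  (contDiff_infty_iff_deriv.1 h.contDiff_angle).2

theorem contDiff_deriv : ContDiff ℝ ∞ (deriv L) := (contDiff_infty_iff_deriv.1 h.smooth).2

theorem contDiff_re : ContDiff ℝ ∞ fun s => (L s).re := Complex.reCLM.contDiff.comp h.smooth

theorem hasDerivAt (s : ℝ) : HasDerivAt L (deriv L s) s :=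
  (h.smooth.differentiable (by simp) s).hasDerivAt

theorem hasDerivAt_angle (s : ℝ) : HasDerivAt (velocityAngle L) (deriv (velocityAngle L) s) s :=
  (h.contDiff_angle.differentiable (by simp) s).hasDerivAt

theorem hasDerivAt_deriv_angle (s : ℝ) :
    HasDerivAt (deriv (velocityAngle L)) (deriv (deriv (velocityAngle L)) s) s :=
  (h.contDiff_deriv_angle.differentiable (by simp) s).hasDerivAt

theorem im_deriv (s : ℝ) : (deriv L s).im = deriv (velocityAngle L) s :=
  (((Complex.imCLM.hasFDerivAt (x := L s)).comp_hasDerivAt s (h.hasDerivAt s)).deriv).symm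

theorem im_deriv_deriv (s : ℝ) : (deriv (deriv L) s).im = deriv (deriv (velocityAngle L)) s := by
  rw [← funext h.im_deriv]
  exact (((Complex.imCLM.hasFDerivAt (x := deriv L s)).comp_hasDerivAt s
    ((h.contDiff_deriv.differentiable (by simp) s).hasDerivAt)).deriv).symm

theorem planeDet_eq_zero_iff (s t : ℝ) : planeDet (deriv f s) (deriv f t) = 0 ↔
    Real.sin (velocityAngle L t - velocityAngle L s) = 0 := by
  rw [h.exp_eq, h.exp_eq, planeDet_exp]
  simp [Real.exp_ne_zero, velocityAngle]

theorem deriv_deriv (s : ℝ) : deriv (deriv f) s = deriv L s * Complex.exp (L s) := by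
  rw [funext h.exp_eq, (h.hasDerivAt s).cexp.deriv, mul_comm]

theorem deriv_deriv_deriv (s : ℝ) : deriv (deriv (deriv f)) s =
    (deriv (deriv L) s + deriv L s ^ 2) * Complex.exp (L s) := by
  rw [funext h.deriv_deriv]
  have := ((h.contDiff_deriv.differentiable (by simp) s).hasDerivAt).mul (h.hasDerivAt s).cexp
  refine this.deriv.trans ?_
  ring

theorem planeDet_deriv_deriv (s : ℝ) : planeDet (deriv f s) (deriv (deriv f) s) =
    ‖deriv f s‖ ^ 2 * deriv (velocityAngle L) s := by
  rw [h.deriv_deriv, h.exp_eq, planeDet_mul_self, h.im_deriv]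

theorem norm_deriv_pos (s : ℝ) : 0 < ‖deriv f s‖ := by
  rw [h.exp_eq, Complex.norm_exp]; exact Real.exp_pos _

/-- Since `f''' / f' = L'' + L'²` and `Im L'² = 2 Re L' · θ'` vanishes with `θ'`, contact of order
exactly two means `θ'' ≠ 0`. -/
theorem deriv_deriv_angle_ne_zero (hgen : IsGenericCurve f) {s : ℝ}
    (hs : deriv (velocityAngle L) s = 0) : deriv (deriv (velocityAngle L)) s ≠ 0 := by
  have h2 : iteratedDeriv 2 f = deriv (deriv f) := by
    rw [iteratedDeriv_succ, iteratedDeriv_one]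
  have h3 : iteratedDeriv 3 f = deriv (deriv (deriv f)) := by rw [iteratedDeriv_succ, h2]
  have := hgen.ordinary s (by rw [h2, h.planeDet_deriv_deriv, hs, mul_zero])
  rw [h3, h.deriv_deriv_deriv, h.exp_eq, planeDet_mul_self] at this
  have hi := right_ne_zero_of_mul this
  simp only [Complex.add_im, pow_two, Complex.mul_im, h.im_deriv, h.im_deriv_deriv, hs] at hi
  simpa using hi

theorem hasInflexionAt_iff (hgen : IsGenericCurve f) (s : ℝ) :
    HasInflexionAt f s ↔ deriv (velocityAngle L) s = 0 := by
  have key : ChangesSignAt (signedCurvature f) s ↔ ChangesSignAt (deriv (velocityAngle L)) s := by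
    refine changesSignAt_congr_mul_pos (q := fun u => ‖deriv f u‖⁻¹)
      (.of_forall fun u => inv_pos.2 (h.norm_deriv_pos u)) (.of_forall fun u => ?_)
    have := (h.norm_deriv_pos u).ne'
    rw [signedCurvature, h.planeDet_deriv_deriv]
    field_simp
  rw [_root_.hasInflexionAt_iff, key]
  constructor
  · exact fun H => H.2.eq_zero (h.hasDerivAt_deriv_angle s).continuousAt
  · exact fun H => ⟨norm_pos_iff.1 (h.norm_deriv_pos s),
      (h.hasDerivAt_deriv_angle s).changesSignAt H (h.deriv_deriv_angle_ne_zero hgen H)⟩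

/-- The inflexions of the image of an arc of parallel pairs under the point map. -/
theorem hasInflexionAt_pointMap_iff {ε : ℝ} (hε : 0 < ε) {s t : ℝ → ℝ}
    (hs : ContDiffOn ℝ ∞ s (Ioo (-ε) ε)) (ht : ContDiffOn ℝ ∞ t (Ioo (-ε) ε))
    (hst : ∀ τ ∈ Ioo (-ε) ε, Real.sin (velocityAngle L (t τ) - velocityAngle L (s τ)) = 0)
    (hf : Differentiable ℝ f) (lam : ℝ) :
    HasInflexionAt (fun τ => pointMap f lam (s τ, t τ)) 0 ↔
      lam * deriv s 0 + (1 - lam) * (Real.cos (velocityAngle L (t 0) - velocityAngle L (s 0)) *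
        Real.exp ((L (t 0)).re - (L (s 0)).re)) * deriv t 0 ≠ 0 ∧
      ChangesSignAt (fun τ => deriv (velocityAngle L) (s τ) * deriv s τ) 0 := by
  have hmem : ∀ τ ∈ Ioo (-ε) ε, Ioo (-ε) ε ∈ 𝓝 τ := fun τ hτ => isOpen_Ioo.mem_nhds hτ
  have h0 : (0 : ℝ) ∈ Ioo (-ε) ε := ⟨by linarith, hε⟩
  have hds : ∀ τ ∈ Ioo (-ε) ε, HasDerivAt s (deriv s τ) τ := fun τ hτ =>
    ((hs.contDiffAt (hmem τ hτ)).differentiableAt (by simp)).hasDerivAt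
  have hdt : ∀ τ ∈ Ioo (-ε) ε, HasDerivAt t (deriv t τ) τ := fun τ hτ =>
    ((ht.contDiffAt (hmem τ hτ)).differentiableAt (by simp)).hasDerivAt
  have hs' : ContDiffOn ℝ ∞ (deriv s) (Ioo (-ε) ε) := hs.deriv_of_isOpen isOpen_Ioo (by simp)
  have ht' : ContDiffOn ℝ ∞ (deriv t) (Ioo (-ε) ε) := ht.deriv_of_isOpen isOpen_Ioo (by simp)
  -- The factor with `cos` and `exp` is the quotient `f'(t) / f'(s)`, real because the sine of the
  -- angle difference vanishes.
  set ρ : ℝ → ℝ := fun τ => lam * deriv s τ + (1 - lam) *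
    (Real.cos (velocityAngle L (t τ) - velocityAngle L (s τ)) *
      Real.exp ((L (t τ)).re - (L (s τ)).re)) * deriv t τ with hρ
  set g : ℝ → ℂ := fun τ => pointMap f lam (s τ, t τ) with hg
  have hρs : ContDiffOn ℝ ∞ ρ (Ioo (-ε) ε) := by
    refine (contDiffOn_const.mul hs').add ((contDiffOn_const.mul (.mul ?_ ?_)).mul ht')
    · exact ((h.contDiff_angle.comp_contDiffOn ht).sub (h.contDiff_angle.comp_contDiffOn hs)).cos
    · exact ((h.contDiff_re.comp_contDiffOn ht).sub (h.contDiff_re.comp_contDiffOn hs)).exp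
  have hdρ : ∀ τ ∈ Ioo (-ε) ε, HasDerivAt ρ (deriv ρ τ) τ := fun τ hτ =>
    ((hρs.contDiffAt (hmem τ hτ)).differentiableAt (by simp)).hasDerivAt
  have hexp : ∀ τ ∈ Ioo (-ε) ε, Complex.exp (L (t τ)) =
      ((Real.cos (velocityAngle L (t τ) - velocityAngle L (s τ)) *
        Real.exp ((L (t τ)).re - (L (s τ)).re) : ℝ) : ℂ) * Complex.exp (L (s τ)) := by
    intro τ hτ
    have e : L (t τ) = (((L (t τ)).re - (L (s τ)).re : ℝ) : ℂ) +
      ((velocityAngle L (t τ) - velocityAngle L (s τ) : ℝ) : ℂ) * Complex.I + L (s τ) := by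
      apply Complex.ext <;> simp [velocityAngle]
    rw [e, Complex.exp_add, Complex.exp_add, Complex.exp_mul_I, ← Complex.ofReal_sin, hst τ hτ]
    simp only [Complex.add_re, velocityAngle]
    simp
    ring
  have hg' : ∀ τ ∈ Ioo (-ε) ε, deriv g τ = ρ τ * Complex.exp (L (s τ)) := by
    intro τ hτ
    have a := ((hf (s τ)).hasDerivAt.scomp τ (hds τ hτ)).const_mul (lam : ℂ)
    have b := ((hf (t τ)).hasDerivAt.scomp τ (hdt τ hτ)).const_mul (((1 - lam : ℝ)) : ℂ)
    refine (a.add b).deriv.trans ?_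
    rw [h.exp_eq, h.exp_eq, hexp τ hτ, hρ]
    simp only [Complex.real_smul, Complex.ofReal_add, Complex.ofReal_mul]
    ring
  have hg'' : ∀ τ ∈ Ioo (-ε) ε, deriv (deriv g) τ =
      (deriv ρ τ + ρ τ * (deriv s τ * deriv L (s τ))) * Complex.exp (L (s τ)) := by
    intro τ hτ
    have e : deriv g =ᶠ[𝓝 τ] fun τ => ρ τ * Complex.exp (L (s τ)) := by
      filter_upwards [hmem τ hτ] using hg'
    rw [e.deriv_eq]
    have := (hdρ τ hτ).ofReal_comp.mul ((h.hasDerivAt (s τ)).scomp τ (hds τ hτ)).cexp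
    refine this.deriv.trans ?_
    simp only [Complex.real_smul]
    simp
    ring
  -- Only the imaginary part of the factor of `exp (L (s τ))` in `g''` contributes, so `ρ'` drops
  -- out.
  have hdet : ∀ τ ∈ Ioo (-ε) ε, planeDet (deriv g τ) (deriv (deriv g) τ) =
      ‖Complex.exp (L (s τ))‖ ^ 2 * ρ τ ^ 2 * (deriv (velocityAngle L) (s τ) * deriv s τ) := by
    intro τ hτ
    rw [hg' τ hτ, hg'' τ hτ, planeDet_real_mul, planeDet_mul_self]
    simp [h.im_deriv]
    ring
  rw [_root_.hasInflexionAt_iff, hg' 0 h0]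
  simp only [ne_eq, mul_eq_zero, Complex.exp_ne_zero, or_false, Complex.ofReal_eq_zero]
  refine and_congr_right fun hρ0 => ?_
  have hρe : ∀ᶠ τ in 𝓝 0, ρ τ ≠ 0 := (hdρ 0 h0).continuousAt.eventually_ne hρ0
  refine changesSignAt_congr_mul_pos
    (q := fun τ => ‖Complex.exp (L (s τ))‖ ^ 2 * ρ τ ^ 2 / ‖deriv g τ‖ ^ 3) ?_ ?_
  · filter_upwards [hρe, hmem 0 h0] with τ hτ hτ'
    rw [hg' τ hτ']
    have h1 := norm_pos_iff.2 (Complex.exp_ne_zero (L (s τ)))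
    have h2 := norm_pos_iff.2 (Complex.ofReal_ne_zero.2 hτ)
    rw [norm_mul]
    positivity
  · filter_upwards [hmem 0 h0] with τ hτ
    rw [signedCurvature, hdet τ hτ]
    ring
end IsLogVelocity

/-! ### Periodicity and parallel pairs -/

theorem Function.Periodic.deriv_of_real {E : Type*} [NormedAddCommGroup E] [NormedSpace ℝ E]
    {g : ℝ → E} {c : ℝ} (hg : Function.Periodic g c) : Function.Periodic (deriv g) c := by
  intro s
  rw [← deriv_comp_add_const, funext hg]

theorem Function.Periodic.add_intCast {E : Type*} {g : ℝ → E} (hg : Function.Periodic g 1)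
    (s : ℝ) (k : ℤ) : g (s + k) = g s := by
  simpa using hg.int_mul k s

theorem Function.Periodic.fract {E : Type*} {g : ℝ → E} (hg : Function.Periodic g 1)
    (s : ℝ) : g (Int.fract s) = g s := by
  conv_rhs => rw [← Int.fract_add_floor s]
  exact (hg.add_intCast _ _).symm

theorem fract_mem_Ico (s : ℝ) : Int.fract s ∈ Ico (0 : ℝ) 1 := ⟨Int.fract_nonneg s, Int.fract_lt_one s⟩

theorem continuous_planeDet : Continuous fun z : ℂ × ℂ => planeDet z.1 z.2 := by
  unfold planeDet; fun_prop

theorem planeDet_swap (u v : ℂ) : planeDet u v = - planeDet v u := by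
  unfold planeDet; ring

theorem planeDet_trans {u v w : ℂ} (hv : v ≠ 0) (h1 : planeDet u v = 0) (h2 : planeDet v w = 0) :
    planeDet u w = 0 := by
  unfold planeDet at *
  have hre : v.re * (u.re * w.im - u.im * w.re) = 0 := by linear_combination w.re * h1 + u.re * h2
  have him : v.im * (u.re * w.im - u.im * w.re) = 0 := by linear_combination w.im * h1 + u.im * h2
  by_contra H
  exact hv (Complex.ext ((mul_eq_zero.1 hre).resolve_right H) ((mul_eq_zero.1 him).resolve_right H))

theorem eq_of_apply_eq_of_deriv_ne_zero {θ θ' : ℝ → ℝ} (hd : ∀ x, HasDerivAt θ (θ' x) x) {u v : ℝ}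
    (huv : θ u = θ v) (hne : ∀ x ∈ uIcc u v, θ' x ≠ 0) : u = v := by
  by_contra H
  rcases lt_or_gt_of_ne H with hlt | hlt
  · obtain ⟨c, hc, hc0⟩ := exists_hasDerivAt_eq_zero hlt
      (fun x _ => (hd x).continuousAt.continuousWithinAt) huv fun x _ => hd x
    exact hne c (by rw [uIcc_of_le hlt.le]; exact Ioo_subset_Icc_self hc) hc0
  · obtain ⟨c, hc, hc0⟩ := exists_hasDerivAt_eq_zero hlt
      (fun x _ => (hd x).continuousAt.continuousWithinAt) huv.symm fun x _ => hd x
    exact hne c (by rw [uIcc_of_ge hlt.le]; exact Ioo_subset_Icc_self hc) hc0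

theorem IsRegularClosedCurve.differentiable {f : ℝ → ℂ} (hf : IsRegularClosedCurve f) :
    Differentiable ℝ f := hf.smooth.differentiable (by simp)

theorem IsRegularClosedCurve.continuous_deriv {f : ℝ → ℂ} (hf : IsRegularClosedCurve f) :
    Continuous (deriv f) := (contDiff_infty_iff_deriv.1 hf.smooth).2.continuous

theorem IsParallelPair.mem_closedParallelPairs {f : ℝ → ℂ} {s t : ℝ} (h : IsParallelPair f s t) :
    (s, t) ∈ closedParallelPairs f := subset_closure h

theorem planeDet_eq_zero_of_mem_closedParallelPairs {f : ℝ → ℂ} (hf : IsRegularClosedCurve f)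
    {x : ℝ × ℝ} (hx : x ∈ closedParallelPairs f) : planeDet (deriv f x.1) (deriv f x.2) = 0 := by
  have hc : IsClosed {x : ℝ × ℝ | planeDet (deriv f x.1) (deriv f x.2) = 0} := by
    have hc := hf.continuous_deriv
    exact isClosed_eq (continuous_planeDet.comp
      ((hc.comp continuous_fst).prodMk (hc.comp continuous_snd))) continuous_const
  exact closure_minimal (fun x hx => hx.2) hc hx

/-- Parallel tangents at distinct parameters of the circle exclude a self-intersection, because
crossings are transverse. -/
theorem IsGenericCurve.isParallelPair {f : ℝ → ℂ} (hf : IsRegularClosedCurve f)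
    (hgen : IsGenericCurve f) {s t : ℝ} (hD : planeDet (deriv f s) (deriv f t) = 0)
    (hst : ∀ k : ℤ, t ≠ s + k) : IsParallelPair f s t := by
  refine ⟨fun heq => ?_, hD⟩
  refine hgen.transverse_crossings _ (fract_mem_Ico s) _ (fract_mem_Ico t) (fun H => ?_) ?_ ?_
  · obtain ⟨k, hk⟩ := Int.fract_eq_fract.1 H.symm
    exact hst k (by linarith)
  · rw [hf.periodic.fract, hf.periodic.fract, heq]
  · rwa [hf.periodic.deriv_of_real.fract, hf.periodic.deriv_of_real.fract]

namespace IsLogVelocity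

variable {f L : ℝ → ℂ} (h : IsLogVelocity f L) (hf : IsRegularClosedCurve f)
include h hf

theorem periodic_deriv_angle : Function.Periodic (deriv (velocityAngle L)) 1 := by
  have e : deriv (velocityAngle L) = fun s => (deriv (deriv f) s / deriv f s).im := by
    funext s
    rw [← h.im_deriv, h.deriv_deriv, h.exp_eq, mul_div_cancel_right₀ _ (Complex.exp_ne_zero _)]
  intro s
  rw [e]
  simp only [hf.periodic.deriv_of_real s, hf.periodic.deriv_of_real.deriv_of_real s]

theorem exp_add_intCast (s : ℝ) (k : ℤ) : Complex.exp (L (s + k)) = Complex.exp (L s) := by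
  rw [← h.exp_eq, ← h.exp_eq, hf.periodic.deriv_of_real.add_intCast]

theorem re_add_intCast (s : ℝ) (k : ℤ) : (L (s + k)).re = (L s).re := by
  have := congrArg (fun z => ‖z‖) (h.exp_add_intCast hf s k)
  simpa [Complex.norm_exp] using this

theorem cos_angle_add_intCast (s : ℝ) (k : ℤ) :
    Real.cos (velocityAngle L (s + k) - velocityAngle L s) = 1 := by
  obtain ⟨n, hn⟩ := Complex.exp_eq_exp_iff_exists_int.1 (h.exp_add_intCast hf s k)
  have : velocityAngle L (s + k) - velocityAngle L s = n * (2 * Real.pi) := by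
    simp [velocityAngle, hn]
  rw [this, Real.cos_int_mul_two_pi]

theorem exists_int_of_inflexions (hgen : IsGenericCurve f) {s t : ℝ}
    (hD : planeDet (deriv f s) (deriv f t) = 0) (hs : deriv (velocityAngle L) s = 0)
    (ht : deriv (velocityAngle L) t = 0) : ∃ k : ℤ, t = s + k := by
  have key : ∀ u, deriv (velocityAngle L) u = 0 → Int.fract u ∈ inflexionParams f := fun u hu =>
    ⟨fract_mem_Ico u, (h.hasInflexionAt_iff hgen _).2
      (by rw [(h.periodic_deriv_angle hf).fract, hu])⟩
  by_contra! H
  refine hgen.inflexions_not_parallel _ (key s hs) _ (key t ht) (fun he => ?_) ?_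
  · obtain ⟨k, hk⟩ := Int.fract_eq_fract.1 he.symm
    exact H k (by linarith)
  · rwa [hf.periodic.deriv_of_real.fract, hf.periodic.deriv_of_real.fract]

-- Near the diagonal the angles differ by less than `π`, and there the sine vanishes only at `0`.
omit hf in
theorem eventually_angle_eq (p : ℝ) : ∀ᶠ x : ℝ × ℝ in 𝓝 (p, p),
    planeDet (deriv f x.1) (deriv f x.2) = 0 → velocityAngle L x.1 = velocityAngle L x.2 := by
  have hc : Continuous fun x : ℝ × ℝ => velocityAngle L x.2 - velocityAngle L x.1 := by
    have := h.contDiff_angle.continuous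
    fun_prop
  have h0 : Ioo (-Real.pi) Real.pi ∈ 𝓝 (velocityAngle L (p, p).2 - velocityAngle L (p, p).1) := by
    rw [sub_self]; exact Ioo_mem_nhds (by linarith [Real.pi_pos]) Real.pi_pos
  filter_upwards [hc.continuousAt.preimage_mem_nhds h0] with x hx hD
  have := (Real.sin_eq_zero_iff_of_lt_of_lt hx.1 hx.2).1 ((h.planeDet_eq_zero_iff _ _).1 hD)
  linarith

/-- Where `θ' ≠ 0` the angle is locally injective, so parallel pairs, whose points differ, cannot
accumulate on the diagonal or its integer translates. -/
theorem deriv_angle_eq_zero_of_mem_closedParallelPairs {s : ℝ} {k : ℤ}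
    (hmem : (s, s + (k : ℝ)) ∈ closedParallelPairs f) : deriv (velocityAngle L) s = 0 := by
  by_contra H
  obtain ⟨δ, hδ, hball⟩ := Metric.eventually_nhds_iff_ball.1
    (h.contDiff_deriv_angle.continuous.continuousAt.eventually_ne H)
  have e1 : ∀ᶠ x : ℝ × ℝ in 𝓝 (s, s), x.1 ∈ Metric.ball s δ ∧ x.2 ∈ Metric.ball s δ := by
    rw [nhds_prod_eq]
    exact prod_mem_prod (Metric.ball_mem_nhds s hδ) (Metric.ball_mem_nhds s hδ)
  have ht : Tendsto (fun x : ℝ × ℝ => (x.1, x.2 - (k : ℝ))) (𝓝 (s, s + (k : ℝ))) (𝓝 (s, s)) := by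
    have : Continuous (fun x : ℝ × ℝ => (x.1, x.2 - (k : ℝ))) := by fun_prop
    simpa using this.tendsto (s, s + (k : ℝ))
  obtain ⟨x, ⟨hx3, hx4⟩, hx1, hx2⟩ := mem_closure_iff_nhds.1 hmem _
    (ht.eventually (e1.and (h.eventually_angle_eq s)))
  have hk : f x.2 = f (x.2 - k) := by
    rw [← hf.periodic.add_intCast (x.2 - k) k, sub_add_cancel]
  have hk' : deriv f x.2 = deriv f (x.2 - k) := by
    rw [← hf.periodic.deriv_of_real.add_intCast (x.2 - k) k, sub_add_cancel]
  have : x.1 = x.2 - k := by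
    refine eq_of_apply_eq_of_deriv_ne_zero h.hasDerivAt_angle (hx4 (by simpa [hk'] using hx2))
      fun y hy => hball y ?_
    exact (convex_ball s δ).ordConnected.uIcc_subset hx3.1 hx3.2 hy
  exact hx1 (by rw [hk, this])

end IsLogVelocity

/-! ### Classification of the inflexions of the branches -/

theorem BranchInflexionAt.swap {f : ℝ → ℂ} {lam : ℝ} {x : ℝ × ℝ} (hx : BranchInflexionAt f lam x) :
    BranchInflexionAt f (1 - lam) x.swap := by
  obtain ⟨ε, c, hε, hc, hc0, hmem, hi⟩ := hx
  refine ⟨ε, fun τ => (c τ).swap, hε, hc.snd.prodMk hc.fst, by simp [hc0], fun τ hτ => ?_, ?_⟩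
  · have : MapsTo Prod.swap {x : ℝ × ℝ | IsParallelPair f x.1 x.2} {x | IsParallelPair f x.1 x.2} :=
      fun x hx => ⟨fun H => hx.1 H.symm, by
        have := hx.2
        rw [planeDet_swap] at this
        exact neg_eq_zero.1 this⟩
    exact this.closure continuous_swap (hmem τ hτ)
  · convert hi using 2 with τ
    simp only [pointMap, Prod.fst_swap, Prod.snd_swap]
    push_cast
    ring

namespace IsLogVelocity

variable {f L : ℝ → ℂ} (h : IsLogVelocity f L)
include h

/-- Differentiate `sin (θ t - θ s) = 0`; the cosine cannot vanish where the sine does. -/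
theorem deriv_angle_mul_deriv_eq {ε : ℝ} {s t : ℝ → ℝ} (hs : ContDiffOn ℝ ∞ s (Ioo (-ε) ε))
    (ht : ContDiffOn ℝ ∞ t (Ioo (-ε) ε))
    (hst : ∀ τ ∈ Ioo (-ε) ε, Real.sin (velocityAngle L (t τ) - velocityAngle L (s τ)) = 0)
    {τ : ℝ} (hτ : τ ∈ Ioo (-ε) ε) : deriv (velocityAngle L) (t τ) * deriv t τ =
      deriv (velocityAngle L) (s τ) * deriv s τ := by
  have hm : Ioo (-ε) ε ∈ 𝓝 τ := isOpen_Ioo.mem_nhds hτ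
  have hds : HasDerivAt s (deriv s τ) τ :=
    ((hs.contDiffAt hm).differentiableAt (by simp)).hasDerivAt
  have hdt : HasDerivAt t (deriv t τ) τ :=
    ((ht.contDiffAt hm).differentiableAt (by simp)).hasDerivAt
  have hd := (((h.hasDerivAt_angle (t τ)).comp τ hdt).sub ((h.hasDerivAt_angle (s τ)).comp τ hds)).sin
  have h0 := hd.congr_of_eventuallyEq (f₁ := fun _ => 0) (by
    filter_upwards [hm] with u hu
    exact (hst u hu).symm)
  have := h0.unique (hasDerivAt_const τ (0 : ℝ))
  have hcos : Real.cos (velocityAngle L (t τ) - velocityAngle L (s τ)) ≠ 0 := by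
    intro H
    have := Real.sin_sq_add_cos_sq (velocityAngle L (t τ) - velocityAngle L (s τ))
    rw [hst τ hτ, H] at this
    norm_num at this
  have := (mul_eq_zero.1 this).resolve_left hcos
  linarith

variable (hf : IsRegularClosedCurve f) (hgen : IsGenericCurve f)
include hf hgen

/-- For `λ = 1/2` a regular image forces `s' = t' ≠ 0`, so both points move to the same side of the
inflexion. There `θ` is injective, the pair becomes diagonal, and diagonal pairs away from
inflexions are not limits of parallel pairs. -/
theorem not_hasInflexionAt_midpoint {s₀ : ℝ} {k : ℤ} (hs₀ : deriv (velocityAngle L) s₀ = 0) :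
    ¬ BranchInflexionAt f (1 / 2) (s₀, s₀ + k) := by
  rintro ⟨ε, c, hε, hc, hc0, hmem, hi⟩
  have hs := hc.fst
  have ht := hc.snd
  have h0 : (0 : ℝ) ∈ Ioo (-ε) ε := ⟨by linarith, hε⟩
  have hm : Ioo (-ε) ε ∈ 𝓝 (0 : ℝ) := isOpen_Ioo.mem_nhds h0
  have hst : ∀ τ ∈ Ioo (-ε) ε,
      Real.sin (velocityAngle L (c τ).2 - velocityAngle L (c τ).1) = 0 := fun τ hτ =>
    (h.planeDet_eq_zero_iff _ _).1 (planeDet_eq_zero_of_mem_closedParallelPairs hf (hmem τ hτ))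
  obtain ⟨hρ, -⟩ := (h.hasInflexionAt_pointMap_iff hε hs ht hst hf.differentiable _).1 hi
  have hθ'' := h.deriv_deriv_angle_ne_zero hgen hs₀
  have hcross := fun τ (hτ : τ ∈ Ioo (-ε) ε) => h.deriv_angle_mul_deriv_eq hs ht hst hτ
  set s : ℝ → ℝ := fun τ => (c τ).1 with hsdef
  set t : ℝ → ℝ := fun τ => (c τ).2 with htdef
  have es : s 0 = s₀ := by simp [hsdef, hc0]
  have et : t 0 = s₀ + k := by simp [htdef, hc0]
  have hds : HasDerivAt s (deriv s 0) 0 :=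
    ((hs.contDiffAt hm).differentiableAt (by simp)).hasDerivAt
  have hdt : HasDerivAt t (deriv t 0) 0 :=
    ((ht.contDiffAt hm).differentiableAt (by simp)).hasDerivAt
  have hds' : HasDerivAt (deriv s) (deriv (deriv s) 0) 0 :=
    (((hs.deriv_of_isOpen isOpen_Ioo (m := ∞) (by simp)).contDiffAt hm).differentiableAt
      (by simp)).hasDerivAt
  have hdt' : HasDerivAt (deriv t) (deriv (deriv t) 0) 0 :=
    (((ht.deriv_of_isOpen isOpen_Ioo (m := ∞) (by simp)).contDiffAt hm).differentiableAt
      (by simp)).hasDerivAt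
  have hper := h.periodic_deriv_angle hf
  have hA := ((h.hasDerivAt_deriv_angle (s 0)).comp 0 hds).mul hds'
  have hB := ((h.hasDerivAt_deriv_angle (t 0)).comp 0 hdt).mul hdt'
  have hAB := hA.unique (hB.congr_of_eventuallyEq (by
    filter_upwards [hm] with τ hτ using (hcross τ hτ).symm))
  simp only [comp_apply, es, et, hper.add_intCast, hper.deriv_of_real.add_intCast, hs₀,
    zero_mul, add_zero] at hAB
  -- Derivative at `0` of `θ'(s) s' = θ'(t) t'`; the second derivatives of `s` and `t` disappear
  -- because `θ' = 0` at the inflexion.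
  have hsq : deriv s 0 * deriv s 0 = deriv t 0 * deriv t 0 := by
    apply mul_left_cancel₀ hθ''
    linarith
  rw [hc0] at hρ
  simp only [h.cos_angle_add_intCast hf, h.re_add_intCast hf, sub_self, Real.exp_zero, mul_one] at hρ
  have hab : deriv s 0 = deriv t 0 := by
    rcases mul_self_eq_mul_self_iff.1 hsq with H | H
    · exact H
    · exact absurd (by rw [H]; ring) hρ
  have ha : deriv s 0 ≠ 0 := fun H => hρ (by rw [← hab, H]; ring)
  -- the two points stay on the same side of the inflexion
  have hside : ∀ᶠ τ in 𝓝[≠] (0 : ℝ), 0 < (s τ - s₀) * (t τ - k - s₀) := by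
    have hl := (hasDerivAt_iff_tendsto_slope.1 hds).mul (hasDerivAt_iff_tendsto_slope.1 hdt)
    have hpos : 0 < deriv s 0 * deriv t 0 := by rw [← hab]; exact mul_self_pos.2 ha
    filter_upwards [hl.eventually (lt_mem_nhds hpos), self_mem_nhdsWithin] with τ hτ hτ0
    have hτ0 : τ ≠ 0 := hτ0
    rw [slope_def_field, slope_def_field, es, et, sub_zero] at hτ
    have : (s τ - s₀) * (t τ - k - s₀) = ((s τ - s₀) / τ * ((t τ - (s₀ + k)) / τ)) * τ ^ 2 := by
      field_simp; ring
    rw [this]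
    positivity
  obtain ⟨δ, hδ, hball⟩ := Metric.eventually_nhds_iff_ball.1
    (eventually_nhdsWithin_iff.1 ((h.hasDerivAt_deriv_angle s₀).eventually_ne hθ'' (c := 0)))
  have hlim : Tendsto (fun τ => (s τ, t τ - (k : ℝ))) (𝓝[≠] 0) (𝓝 (s₀, s₀)) := by
    have h1 := hds.continuousAt.tendsto
    have h2 := hdt.continuousAt.tendsto.sub_const (k : ℝ)
    rw [es] at h1
    rw [et, add_sub_cancel_right] at h2
    exact (h1.prodMk_nhds h2).mono_left nhdsWithin_le_nhds
  have e1 : ∀ᶠ x : ℝ × ℝ in 𝓝 (s₀, s₀), x.1 ∈ Metric.ball s₀ δ ∧ x.2 ∈ Metric.ball s₀ δ := by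
    rw [nhds_prod_eq]
    exact prod_mem_prod (Metric.ball_mem_nhds s₀ hδ) (Metric.ball_mem_nhds s₀ hδ)
  obtain ⟨τ, ⟨⟨hb1, hb2⟩, hang⟩, hpos, hτ⟩ := ((hlim.eventually
    (e1.and (h.eventually_angle_eq s₀))).and
      (hside.and (mem_nhdsWithin_of_mem_nhds hm))).exists
  dsimp only at hb1 hb2 hang
  have hk' : deriv f (t τ) = deriv f (t τ - k) := by
    rw [← hf.periodic.deriv_of_real.add_intCast (t τ - k) k, sub_add_cancel]
  have heq : s τ = t τ - k := by
    refine eq_of_apply_eq_of_deriv_ne_zero h.hasDerivAt_angle (hang ?_) fun y hy => hball y ?_ ?_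
    · rw [← hk']
      exact planeDet_eq_zero_of_mem_closedParallelPairs hf (hmem τ hτ)
    · exact (convex_ball s₀ δ).ordConnected.uIcc_subset hb1 hb2 hy
    · rintro rfl
      rcases mem_uIcc.1 hy with ⟨h1, h2⟩ | ⟨h1, h2⟩ <;> nlinarith
  have hne : s τ ≠ s₀ := fun H => by simp [H] at hpos
  refine hball (s τ) hb1 hne (h.deriv_angle_eq_zero_of_mem_closedParallelPairs hf (k := k) ?_)
  have hcτ : c τ = (s τ, s τ + k) := Prod.ext rfl (by
    change t τ = s τ + k
    linarith)
  rw [← hcτ]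
  exact hmem τ hτ

/-- The sign change gives `θ'(s) s' = 0`, hence `θ'(t) t' = 0`. A nonzero `θ'` kills the
corresponding velocity, and `ρ ≠ 0` then restricts `lam`. -/
theorem of_branchInflexionAt {lam s₀ t₀ : ℝ} (H : BranchInflexionAt f lam (s₀, t₀)) :
    planeDet (deriv f s₀) (deriv f t₀) = 0 ∧
      ((deriv (velocityAngle L) s₀ = 0 ∧ deriv (velocityAngle L) t₀ ≠ 0 ∧ lam ≠ 0) ∨
       (deriv (velocityAngle L) s₀ ≠ 0 ∧ deriv (velocityAngle L) t₀ = 0 ∧ lam ≠ 1) ∨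
       (deriv (velocityAngle L) s₀ = 0 ∧ deriv (velocityAngle L) t₀ = 0 ∧ lam ≠ 1 / 2)) := by
  have H' := H
  obtain ⟨ε, c, hε, hc, hc0, hmem, hi⟩ := H
  have hs := hc.fst
  have ht := hc.snd
  have h0 : (0 : ℝ) ∈ Ioo (-ε) ε := ⟨by linarith, hε⟩
  have hm : Ioo (-ε) ε ∈ 𝓝 (0 : ℝ) := isOpen_Ioo.mem_nhds h0
  have hst : ∀ τ ∈ Ioo (-ε) ε,
      Real.sin (velocityAngle L (c τ).2 - velocityAngle L (c τ).1) = 0 := fun τ hτ =>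
    (h.planeDet_eq_zero_iff _ _).1 (planeDet_eq_zero_of_mem_closedParallelPairs hf (hmem τ hτ))
  have hD := planeDet_eq_zero_of_mem_closedParallelPairs hf (hmem 0 h0)
  obtain ⟨hρ, hsign⟩ := (h.hasInflexionAt_pointMap_iff hε hs ht hst hf.differentiable _).1 hi
  have hcross := h.deriv_angle_mul_deriv_eq hs ht hst h0
  have hzero := hsign.eq_zero (by
    have h1 : ContinuousAt (deriv fun τ => (c τ).1) 0 :=
      ((hs.deriv_of_isOpen isOpen_Ioo (m := ∞) (by simp)).contDiffAt hm).continuousAt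
    have h2 : ContinuousAt (fun τ => deriv (velocityAngle L) (c τ).1) 0 :=
      h.contDiff_deriv_angle.continuous.continuousAt.comp (hs.contDiffAt hm).continuousAt
    exact h2.mul h1)
  rw [hzero] at hcross
  simp only [hc0] at hzero hcross hρ hD
  refine ⟨hD, ?_⟩
  by_cases hS : deriv (velocityAngle L) s₀ = 0 <;> by_cases hT : deriv (velocityAngle L) t₀ = 0
  · refine .inr (.inr ⟨hS, hT, ?_⟩)
    rintro rfl
    obtain ⟨k, rfl⟩ := h.exists_int_of_inflexions hf hgen hD hS hT
    exact h.not_hasInflexionAt_midpoint hf hgen hS H'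
  · refine .inl ⟨hS, hT, ?_⟩
    rintro rfl
    exact hρ (by rw [(mul_eq_zero.1 hcross).resolve_left hT]; ring)
  · refine .inr (.inl ⟨hS, hT, ?_⟩)
    rintro rfl
    exact hρ (by rw [(mul_eq_zero.1 hzero).resolve_left hS]; ring)
  · exact absurd (by rw [(mul_eq_zero.1 hcross).resolve_left hT,
      (mul_eq_zero.1 hzero).resolve_left hS]; ring) hρ

/-- With `s` itself as the parameter, `θ'(s) s'` has a simple zero and so changes sign; only `ρ ≠ 0`
remains to be assumed. -/
theorem branchInflexionAt_of_graph {lam s₀ : ℝ} (hs₀ : deriv (velocityAngle L) s₀ = 0) {T : ℝ → ℝ}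
    (hT : ∀ᶠ τ in 𝓝 0, ContDiffAt ℝ ∞ T τ)
    (hmem : ∀ᶠ τ in 𝓝 0, (s₀ + τ, T τ) ∈ closedParallelPairs f)
    (hρ : lam + (1 - lam) * (Real.cos (velocityAngle L (T 0) - velocityAngle L s₀) *
        Real.exp ((L (T 0)).re - (L s₀).re)) * deriv T 0 ≠ 0) :
    BranchInflexionAt f lam (s₀, T 0) := by
  obtain ⟨ε, hε, hball⟩ := Metric.eventually_nhds_iff_ball.1 (hT.and hmem)
  rw [Real.ball_eq_Ioo, zero_sub, zero_add] at hball
  have hs : ContDiffOn ℝ ∞ (fun τ => s₀ + τ) (Ioo (-ε) ε) := by fun_prop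
  have ht : ContDiffOn ℝ ∞ T (Ioo (-ε) ε) := fun τ hτ => (hball τ hτ).1.contDiffWithinAt
  refine ⟨ε, fun τ => (s₀ + τ, T τ), hε, hs.prodMk ht, by simp, fun τ hτ => (hball τ hτ).2, ?_⟩
  have hst : ∀ τ ∈ Ioo (-ε) ε,
      Real.sin (velocityAngle L (T τ) - velocityAngle L (s₀ + τ)) = 0 := fun τ hτ =>
    (h.planeDet_eq_zero_iff _ _).1
      (planeDet_eq_zero_of_mem_closedParallelPairs hf (hball τ hτ).2)
  have hd : deriv (fun τ => s₀ + τ) = fun _ => 1 := by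
    funext τ
    simp
  refine (h.hasInflexionAt_pointMap_iff hε hs ht hst hf.differentiable _).2 ⟨?_, ?_⟩
  · simpa [hd] using hρ
  · simp only [hd, mul_one]
    have hd2 : HasDerivAt (fun τ => deriv (velocityAngle L) (s₀ + τ))
        (deriv (deriv (velocityAngle L)) s₀) 0 := by
      have := (h.hasDerivAt_deriv_angle (s₀ + 0)).comp_const_add s₀ 0
      simpa using this
    exact hd2.changesSignAt (by simpa using hs₀) (h.deriv_deriv_angle_ne_zero hgen hs₀)

theorem branchInflexionAt_of_ne_zero {lam s₀ t₀ : ℝ} (hD : planeDet (deriv f s₀) (deriv f t₀) = 0)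
    (hs₀ : deriv (velocityAngle L) s₀ = 0) (ht₀ : deriv (velocityAngle L) t₀ ≠ 0) (hlam : lam ≠ 0) :
    BranchInflexionAt f lam (s₀, t₀) := by
  obtain ⟨ψ, hψ0, hψ⟩ := exists_smooth_local_inverse
    (.of_forall fun x => h.contDiff_angle.contDiffAt) (h.hasDerivAt_angle t₀) ht₀
  -- The angle required at the partner of `s₀ + τ`; the local inverse `ψ` of `θ` at `t₀` turns it
  -- into a parameter.
  set q : ℝ → ℝ := fun τ =>
    velocityAngle L (s₀ + τ) - velocityAngle L s₀ + velocityAngle L t₀ with hq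
  have hqs : ContDiff ℝ ∞ q := by
    have := h.contDiff_angle
    fun_prop
  have hq0 : q 0 = velocityAngle L t₀ := by simp [hq]
  have hqt : Tendsto q (𝓝 0) (𝓝 (velocityAngle L t₀)) := by
    simpa only [hq0] using hqs.continuous.tendsto 0
  have hT : ∀ᶠ τ in 𝓝 0, ContDiffAt ℝ ∞ (fun τ => ψ (q τ)) τ :=
    (hqt.eventually hψ).mono fun τ hτ => hτ.1.comp τ hqs.contDiffAt
  have hT0 : ψ (q 0) = t₀ := by rw [hq0, hψ0]
  have hsin : ∀ᶠ τ in 𝓝 0, planeDet (deriv f (s₀ + τ)) (deriv f (ψ (q τ))) = 0 := by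
    filter_upwards [hqt.eventually hψ] with τ hτ
    rw [h.planeDet_eq_zero_iff, hτ.2, ← (h.planeDet_eq_zero_iff _ _).1 hD]
    congr 1
    simp only [hq]; ring
  have hpair : IsParallelPair f s₀ t₀ := hgen.isParallelPair hf hD fun k hk => ht₀ (by
    rw [hk, (h.periodic_deriv_angle hf).add_intCast, hs₀])
  -- The partner is stationary to first order because the angle is stationary at the inflexion;
  -- hence `ρ = λ`.
  have hTd : HasDerivAt (fun τ => ψ (q τ)) 0 0 := by
    have h1 := (hT.self_of_nhds.differentiableAt (by simp)).hasDerivAt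
    have h2 := (h.hasDerivAt_angle (ψ (q 0))).comp 0 h1
    have h3 : HasDerivAt q 0 0 := by
      have := (((h.hasDerivAt_angle (s₀ + 0)).comp_const_add s₀ 0).sub_const
        (velocityAngle L s₀)).add_const (velocityAngle L t₀)
      exact this.congr_deriv (by simp [hs₀])
    have h4 := h2.unique (h3.congr_of_eventuallyEq
      ((hqt.eventually hψ).mono fun τ hτ => hτ.2))
    rw [hT0] at h4
    rwa [(mul_eq_zero.1 h4).resolve_left ht₀] at h1
  rw [← hT0]
  refine h.branchInflexionAt_of_graph hf hgen hs₀ (T := fun τ => ψ (q τ)) hT ?_ ?_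
  · have hfne : ∀ᶠ τ in 𝓝 0, f (s₀ + τ) - f (ψ (q τ)) ≠ 0 := by
      have hc : ContinuousAt (fun τ => f (s₀ + τ) - f (ψ (q τ))) 0 := by
        have hfc := hf.differentiable.continuous
        exact ((hfc.comp (continuous_const_add s₀)).continuousAt).sub
          (hfc.continuousAt.comp hT.self_of_nhds.continuousAt)
      refine hc.eventually_ne ?_
      rw [hT0, add_zero]
      exact sub_ne_zero.2 hpair.1
    filter_upwards [hfne, hsin] with τ h1 h2
    exact IsParallelPair.mem_closedParallelPairs ⟨sub_ne_zero.1 h1, h2⟩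
  · rw [hTd.deriv]
    simpa using hlam

/-- The branch is the graph of the involution preserving `θ`; its derivative `-1` gives `ρ = 2λ -
1`. -/
theorem branchInflexionAt_diagonal {lam s₀ : ℝ} (hs₀ : deriv (velocityAngle L) s₀ = 0)
    (hlam : lam ≠ 1 / 2) (k : ℤ) : BranchInflexionAt f lam (s₀, s₀ + k) := by
  obtain ⟨σ, hσ0, hσd, hσs, hσθ, hσne⟩ := exists_smooth_involution h.contDiff_angle hs₀
    (h.deriv_deriv_angle_ne_zero hgen hs₀)
  have hadd : Tendsto (fun τ => s₀ + τ) (𝓝 0) (𝓝 s₀) := by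
    simpa using (continuous_const_add s₀).tendsto 0
  have hadd' : Tendsto (fun τ => s₀ + τ) (𝓝[≠] 0) (𝓝[≠] s₀) :=
    tendsto_nhdsWithin_iff.2 ⟨hadd.mono_left nhdsWithin_le_nhds, by
      filter_upwards [self_mem_nhdsWithin] with τ hτ
      simpa using hτ⟩
  have hT : ∀ᶠ τ in 𝓝 0, ContDiffAt ℝ ∞ (fun τ => σ (s₀ + τ) + k) τ :=
    (hadd.eventually hσs).mono fun τ hτ =>
      (hτ.comp τ (contDiffAt_const.add contDiffAt_id)).add contDiffAt_const
  have hTd : HasDerivAt (fun τ => σ (s₀ + τ) + (k : ℝ)) (-1) 0 := by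
    have h1 : HasDerivAt σ (-1) (s₀ + 0) := by rwa [add_zero]
    exact (h1.comp_const_add s₀ 0).add_const _
  have hpunct : ∀ᶠ τ in 𝓝[≠] 0, (s₀ + τ, σ (s₀ + τ) + (k : ℝ)) ∈ closedParallelPairs f := by
    -- A displacement below `1` rules out nonzero integer differences, and `hσne` rules out zero.
    have hclose : ∀ᶠ x in 𝓝 s₀, |σ x - x| < 1 := by
      have : ContinuousAt (fun x => |σ x - x|) s₀ :=
        (hσs.self_of_nhds.continuousAt.sub continuousAt_id).abs
      refine this.eventually (gt_mem_nhds ?_)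
      simp [hσ0]
    filter_upwards [hadd'.eventually hσne,
      (hadd.eventually hσθ).filter_mono nhdsWithin_le_nhds,
      (hadd.eventually hclose).filter_mono nhdsWithin_le_nhds] with τ h1 h2 h3
    refine IsParallelPair.mem_closedParallelPairs (hgen.isParallelPair hf ?_ ?_)
    · rw [hf.periodic.deriv_of_real.add_intCast, h.planeDet_eq_zero_iff, h2, sub_self, Real.sin_zero]
    · intro n hn
      have e : σ (s₀ + τ) - (s₀ + τ) = ((n - k : ℤ) : ℝ) := by push_cast; linarith
      rw [e, ← Int.cast_abs] at h3
      have h4 : |n - k| < 1 := by exact_mod_cast h3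
      rw [Int.abs_lt_one_iff] at h4
      rw [h4, Int.cast_zero, sub_eq_zero] at e
      exact h1 e
  -- The central pair is not a parallel pair; it is only a limit of such pairs along the branch.
  have hzero : (s₀ + (0 : ℝ), σ (s₀ + 0) + (k : ℝ)) ∈ closedParallelPairs f := by
    refine isClosed_closure.mem_of_tendsto ?_ hpunct
    have hc : ContinuousAt (fun τ => (s₀ + τ, σ (s₀ + τ) + (k : ℝ))) 0 :=
      (continuous_const_add s₀).continuousAt.prodMk hTd.continuousAt
    exact hc.tendsto.mono_left nhdsWithin_le_nhds
  have hT0 : σ (s₀ + 0) + (k : ℝ) = s₀ + k := by rw [add_zero, hσ0]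
  rw [← hT0]
  refine h.branchInflexionAt_of_graph hf hgen hs₀ (T := fun τ => σ (s₀ + τ) + k) hT ?_ ?_
  · have := eventually_nhdsWithin_iff.1 hpunct
    filter_upwards [this] with τ hτ
    rcases eq_or_ne τ 0 with rfl | h0
    · exact hzero
    · exact hτ h0
  · rw [hTd.deriv, hT0, h.cos_angle_add_intCast hf, h.re_add_intCast hf, sub_self, Real.exp_zero]
    intro H
    exact hlam (by linarith)

theorem branchInflexionAt_iff (lam s₀ t₀ : ℝ) : BranchInflexionAt f lam (s₀, t₀) ↔
    planeDet (deriv f s₀) (deriv f t₀) = 0 ∧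
      ((deriv (velocityAngle L) s₀ = 0 ∧ deriv (velocityAngle L) t₀ ≠ 0 ∧ lam ≠ 0) ∨
       (deriv (velocityAngle L) s₀ ≠ 0 ∧ deriv (velocityAngle L) t₀ = 0 ∧ lam ≠ 1) ∨
       (deriv (velocityAngle L) s₀ = 0 ∧ deriv (velocityAngle L) t₀ = 0 ∧ lam ≠ 1 / 2)) := by
  refine ⟨h.of_branchInflexionAt hf hgen, ?_⟩
  rintro ⟨hD, ⟨hs, ht, hl⟩ | ⟨hs, ht, hl⟩ | ⟨hs, ht, hl⟩⟩
  · exact h.branchInflexionAt_of_ne_zero hf hgen hD hs ht hl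
  · rw [planeDet_swap, neg_eq_zero] at hD
    simpa using (h.branchInflexionAt_of_ne_zero hf hgen hD ht hs (sub_ne_zero.2 hl.symm)).swap
  · obtain ⟨k, rfl⟩ := h.exists_int_of_inflexions hf hgen hD hs ht
    exact h.branchInflexionAt_diagonal hf hgen hs hl k

end IsLogVelocity

/-! ### The angle function and the parallel points -/

theorem addCircle_pi_coe_eq_coe_iff (x y : ℝ) :
    (x : AddCircle Real.pi) = (y : AddCircle Real.pi) ↔ Real.sin (x - y) = 0 := by
  rw [← sub_eq_zero, ← AddCircle.coe_sub, AddCircle.coe_eq_zero_iff, Real.sin_eq_zero_iff]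
  simp

theorem eventually_ne_zero_of_deriv {u u' : ℝ → ℝ} (hd : ∀ x, HasDerivAt u (u' x) x) {p : ℝ}
    (hp : u p = 0) (hne : ∀ᶠ x in 𝓝[≠] p, u' x ≠ 0) : ∀ᶠ x in 𝓝[≠] p, u x ≠ 0 := by
  obtain ⟨δ, hδ, hball⟩ := Metric.eventually_nhds_iff_ball.1 (eventually_nhdsWithin_iff.1 hne)
  rw [eventually_nhdsWithin_iff]
  filter_upwards [Metric.ball_mem_nhds p hδ] with x hx hxp H
  have hsub : uIcc p x ⊆ Metric.ball p δ :=
    (convex_ball p δ).ordConnected.uIcc_subset (Metric.mem_ball_self hδ) hx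
  have hc : ContinuousOn u (uIcc p x) := fun y _ => (hd y).continuousAt.continuousWithinAt
  rcases lt_or_gt_of_ne (show x ≠ p from hxp) with hlt | hlt
  · rw [uIcc_of_ge hlt.le] at hsub hc
    obtain ⟨c, hc1, hc2⟩ := exists_hasDerivAt_eq_zero hlt hc (by rw [H, hp]) fun x _ => hd x
    exact hball c (hsub (Ioo_subset_Icc_self hc1)) hc1.2.ne hc2
  · rw [uIcc_of_le hlt.le] at hsub hc
    obtain ⟨c, hc1, hc2⟩ := exists_hasDerivAt_eq_zero hlt hc (by rw [H, hp]) fun x _ => hd x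
    exact hball c (hsub (Ioo_subset_Icc_self hc1)) hc1.1.ne' hc2

/-- Every point of the curve has a partner with parallel tangent line. -/
theorem IsGenericCurve.exists_isParallelPair {f : ℝ → ℂ} (hf : IsRegularClosedCurve f)
    (hgen : IsGenericCurve f) (s : ℝ) :
    ∃ t, IsParallelPair f s t := by
  have hd : ∀ x, HasDerivAt (fun t => planeDet (deriv f s) (f t))
      (planeDet (deriv f s) (deriv f x)) x := by
    intro x
    have hx := (hf.differentiable x).hasDerivAt
    have hre := (Complex.reCLM.hasFDerivAt (x := f x)).comp_hasDerivAt x hx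
    have him := (Complex.imCLM.hasFDerivAt (x := f x)).comp_hasDerivAt x hx
    exact (him.const_mul (deriv f s).re).sub (hre.const_mul (deriv f s).im)
  -- Rolle over one period, for the height of the curve above the tangent direction at `s`; the zero
  -- is interior, so it is not a translate of `s`.
  obtain ⟨t, ht, ht0⟩ := exists_hasDerivAt_eq_zero (lt_add_one s)
    (fun x _ => (hd x).continuousAt.continuousWithinAt) (by rw [hf.periodic s]) fun x _ => hd x
  refine ⟨t, hgen.isParallelPair hf ht0 fun k hk => ?_⟩
  have h1 : (0 : ℝ) < k := by linarith [ht.1]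
  have h2 : (k : ℝ) < 1 := by linarith [ht.2]
  have h3 : (0 : ℤ) < k := by exact_mod_cast h1
  have h4 : k < 1 := by exact_mod_cast h2
  omega

namespace IsLogVelocity

variable {f L : ℝ → ℂ} (h : IsLogVelocity f L)
include h

theorem angleFunction_eq (s : ℝ) :
    angleFunction f s = ((velocityAngle L s - velocityAngle L 0 : ℝ) : AddCircle Real.pi) := by
  have key : ∀ s, ∃ n : ℤ, Complex.arg (deriv f s) = velocityAngle L s + n * (2 * Real.pi) := by
    intro s
    obtain ⟨n, hn⟩ := Complex.exp_eq_exp_iff_exists_int.1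
      (Complex.exp_log (Complex.exp_ne_zero (L s)))
    refine ⟨n, ?_⟩
    rw [h.exp_eq, ← Complex.log_im, hn]
    simp [velocityAngle]
  obtain ⟨n, hn⟩ := key s
  obtain ⟨m, hm⟩ := key 0
  rw [angleFunction, addCircle_pi_coe_eq_coe_iff, hn, hm, Real.sin_eq_zero_iff]
  exact ⟨2 * (n - m), by push_cast; ring⟩

theorem angleFunction_eq_iff (s t : ℝ) :
    angleFunction f s = angleFunction f t ↔ planeDet (deriv f t) (deriv f s) = 0 := by
  rw [h.angleFunction_eq, h.angleFunction_eq, addCircle_pi_coe_eq_coe_iff, h.planeDet_eq_zero_iff]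
  simp

theorem angleExtremumAt_iff (hgen : IsGenericCurve f) (s : ℝ) :
    AngleExtremumAt f s ↔ deriv (velocityAngle L) s = 0 := by
  constructor
  · rintro ⟨ϑ, hϑ, he, h0, -⟩
    -- Any lift agrees with `θ - θ 0` modulo `π`; differentiating the sine of the difference shows
    -- that the derivatives agree at `s`.
    have hd := (((hϑ.differentiableAt (by simp)).hasDerivAt.sub
      ((h.hasDerivAt_angle s).sub_const (velocityAngle L 0)))).sin
    have he' : ∀ᶠ u in 𝓝 s, Real.sin (ϑ u - (velocityAngle L u - velocityAngle L 0)) = 0 :=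
      he.mono fun u hu => by rwa [h.angleFunction_eq, addCircle_pi_coe_eq_coe_iff] at hu
    have := (hd.congr_of_eventuallyEq (f₁ := fun _ => 0)
      (he'.mono fun u hu => hu.symm)).unique (hasDerivAt_const s (0 : ℝ))
    rcases mul_eq_zero.1 this with H | H
    · have h1 := Real.sin_sq_add_cos_sq (ϑ s - (velocityAngle L s - velocityAngle L 0))
      simp only [Pi.sub_apply] at H
      rw [he'.self_of_nhds, H] at h1
      norm_num at h1
    · linarith
  · intro hs
    refine ⟨fun u => velocityAngle L u - velocityAngle L 0,
      (contDiff_infty.1 (h.contDiff_angle.sub contDiff_const) 2).contDiffAt,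
      .of_forall fun u => (h.angleFunction_eq u).symm, ?_, ?_⟩
    · rwa [deriv_sub_const]
    · have : deriv (fun u => velocityAngle L u - velocityAngle L 0) = deriv (velocityAngle L) := by
        funext u
        rw [deriv_sub_const]
      rw [this]
      exact h.deriv_deriv_angle_ne_zero hgen hs

theorem inflexionParams_eq (hgen : IsGenericCurve f) :
    inflexionParams f = {s | s ∈ Ico (0 : ℝ) 1 ∧ deriv (velocityAngle L) s = 0} := by
  ext s
  simp only [inflexionParams, mem_ofPred_eq, h.hasInflexionAt_iff hgen]

/-- Zeros of `sin (θ t - θ s)` are isolated: near one the cosine is nonzero, and `θ'` has only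
isolated zeros. Compactness of the period does the rest. -/
theorem finite_setOf_parallel (hgen : IsGenericCurve f) (s : ℝ) :
    {t | t ∈ Ico (0 : ℝ) 1 ∧ planeDet (deriv f s) (deriv f t) = 0}.Finite := by
  by_contra hinf
  obtain ⟨p, -, hp⟩ := Set.Infinite.exists_accPt_of_subset_isCompact hinf
    (isCompact_Icc (a := (0 : ℝ)) (b := 1)) fun t ht => Ico_subset_Icc_self ht.1
  rw [accPt_iff_frequently_nhdsNE] at hp
  set u : ℝ → ℝ := fun t => Real.sin (velocityAngle L t - velocityAngle L s) with hu
  have hd : ∀ t, HasDerivAt u (Real.cos (velocityAngle L t - velocityAngle L s) *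
      deriv (velocityAngle L) t) t := fun t => ((h.hasDerivAt_angle t).sub_const _).sin
  have hfreq : ∃ᶠ t in 𝓝[≠] p, u t = 0 :=
    hp.mono fun t ht => (h.planeDet_eq_zero_iff _ _).1 ht.2
  have hup : u p = 0 := by
    by_contra H
    exact hfreq (((hd p).continuousAt.eventually_ne H).filter_mono nhdsWithin_le_nhds)
  refine hfreq (eventually_ne_zero_of_deriv hd hup ?_)
  have hcos : Real.cos (velocityAngle L p - velocityAngle L s) ≠ 0 := by
    intro H
    have := Real.sin_sq_add_cos_sq (velocityAngle L p - velocityAngle L s)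
    simp only [hu] at hup
    rw [hup, H] at this
    norm_num at this
  have hcos' : ∀ᶠ t in 𝓝[≠] p, Real.cos (velocityAngle L t - velocityAngle L s) ≠ 0 :=
    ((Real.continuous_cos.comp
      (h.contDiff_angle.continuous.sub continuous_const)).continuousAt.eventually_ne hcos).filter_mono nhdsWithin_le_nhds
  have hθ' : ∀ᶠ t in 𝓝[≠] p, deriv (velocityAngle L) t ≠ 0 := by
    by_cases H : deriv (velocityAngle L) p = 0
    · exact (h.hasDerivAt_deriv_angle p).eventually_ne (h.deriv_deriv_angle_ne_zero hgen H)
    · exact ((h.hasDerivAt_deriv_angle p).continuousAt.eventually_ne H).filter_mono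
        nhdsWithin_le_nhds
  filter_upwards [hcos', hθ'] with t h1 h2 using mul_ne_zero h1 h2

variable (hf : IsRegularClosedCurve f) (hgen : IsGenericCurve f)
include hf hgen

theorem parallelPoints_eq (hne : (inflexionParams f).Nonempty) : parallelPoints f =
    {t | t ∈ Ico (0 : ℝ) 1 ∧ ∃ s ∈ inflexionParams f, planeDet (deriv f s) (deriv f t) = 0} := by
  have he : (angleExtrema f).Nonempty := by
    obtain ⟨s, hs⟩ := hne
    rw [h.inflexionParams_eq hgen] at hs
    exact ⟨_, s, rfl, (h.angleExtremumAt_iff hgen s).2 hs.2⟩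
  rw [parallelPoints, if_pos he]
  ext t
  refine and_congr_right fun _ => ?_
  constructor
  · rintro ⟨s, hs, hs'⟩
    rw [h.angleExtremumAt_iff hgen] at hs'
    refine ⟨Int.fract s, ?_, ?_⟩
    · rw [h.inflexionParams_eq hgen]
      exact ⟨fract_mem_Ico s, by rwa [(h.periodic_deriv_angle hf).fract]⟩
    · rw [hf.periodic.deriv_of_real.fract, planeDet_swap, neg_eq_zero]
      exact (h.angleFunction_eq_iff _ _).1 hs
  · rintro ⟨s, hs, hD⟩
    rw [h.inflexionParams_eq hgen] at hs
    refine ⟨s, (h.angleFunction_eq_iff _ _).2 ?_, (h.angleExtremumAt_iff hgen s).2 hs.2⟩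
    rwa [planeDet_swap, neg_eq_zero]

end IsLogVelocity

/-! ### Counting the inflexions -/

/-- Ordered pairs of parameters in the circle with parallel tangent lines, the first of which, but
not the second, is an inflexion. -/
def properInflexionPairs (f : ℝ → ℂ) : Set (ℝ × ℝ) :=
  {x | x.1 ∈ inflexionParams f ∧ x.2 ∈ Ico (0 : ℝ) 1 ∧ x.2 ∉ inflexionParams f ∧
    planeDet (deriv f x.1) (deriv f x.2) = 0}

theorem mem_properInflexionPairs {f : ℝ → ℂ} {x : ℝ × ℝ} : x ∈ properInflexionPairs f ↔
    x.1 ∈ inflexionParams f ∧ x.2 ∈ Ico (0 : ℝ) 1 ∧ x.2 ∉ inflexionParams f ∧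
      planeDet (deriv f x.1) (deriv f x.2) = 0 := Iff.rfl

theorem IsGenericCurve.eq_of_planeDet_eq_zero {f : ℝ → ℂ} (hgen : IsGenericCurve f) {s t : ℝ}
    (hs : s ∈ inflexionParams f) (ht : t ∈ inflexionParams f)
    (hD : planeDet (deriv f s) (deriv f t) = 0) : s = t := by
  by_contra H
  exact hgen.inflexions_not_parallel s hs t ht H hD

/-- Two inflexions parallel to the same point are parallel to each other, hence equal. -/
theorem IsGenericCurve.injOn_snd_properInflexionPairs {f : ℝ → ℂ} (hf : IsRegularClosedCurve f)
    (hgen : IsGenericCurve f) : InjOn Prod.snd (properInflexionPairs f) := by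
  rintro ⟨s, t⟩ ⟨hs, -, -, hD⟩ ⟨s', t'⟩ ⟨hs', -, -, hD'⟩ (rfl : t = t')
  dsimp only at hs hs' hD hD'
  rw [planeDet_swap, neg_eq_zero] at hD'
  rw [hgen.eq_of_planeDet_eq_zero hs hs' (planeDet_trans (hf.regular t) hD hD')]

theorem properInflexionPairs_disjoint_swap (f : ℝ → ℂ) :
    Disjoint (properInflexionPairs f) (Prod.swap '' properInflexionPairs f) := by
  rw [Set.disjoint_left]
  rintro _ ⟨-, -, h1, -⟩ ⟨y, ⟨h2, -, -, -⟩, rfl⟩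
  exact h1 h2

theorem mem_swap_image_properInflexionPairs {f : ℝ → ℂ} {x : ℝ × ℝ} :
    x ∈ Prod.swap '' properInflexionPairs f ↔ x.swap ∈ properInflexionPairs f := by
  rw [image_swap_eq_preimage_swap, mem_preimage]

namespace IsLogVelocity

variable {f L : ℝ → ℂ} (h : IsLogVelocity f L) (hf : IsRegularClosedCurve f)
  (hgen : IsGenericCurve f)
include h hf hgen

theorem snd_image_properInflexionPairs (hne : (inflexionParams f).Nonempty) :
    Prod.snd '' properInflexionPairs f = parallelPoints f \ inflexionParams f := by
  rw [h.parallelPoints_eq hf hgen hne]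
  ext t
  constructor
  · rintro ⟨⟨s, t⟩, ⟨h1, h2, h3, h4⟩, rfl⟩
    exact ⟨⟨h2, s, h1, h4⟩, h3⟩
  · rintro ⟨⟨h2, s, h1, h4⟩, h3⟩
    exact ⟨(s, t), ⟨h1, h2, h3, h4⟩, rfl⟩

theorem inflexionParams_subset_parallelPoints (hne : (inflexionParams f).Nonempty) :
    inflexionParams f ⊆ parallelPoints f := by
  rw [h.parallelPoints_eq hf hgen hne]
  exact fun s hs => ⟨hs.1, s, hs, by rw [planeDet]; ring⟩

theorem finite_parallelPoints (hne : (inflexionParams f).Nonempty)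
    (hfin : (inflexionParams f).Finite) : (parallelPoints f).Finite := by
  rw [h.parallelPoints_eq hf hgen hne]
  refine (hfin.biUnion fun s _ => h.finite_setOf_parallel hgen s).subset ?_
  rintro t ⟨ht, s, hs, hD⟩
  exact mem_biUnion hs ⟨ht, hD⟩

theorem finite_properInflexionPairs (hne : (inflexionParams f).Nonempty)
    (hfin : (inflexionParams f).Finite) : (properInflexionPairs f).Finite := by
  refine Finite.of_finite_image ?_ (hgen.injOn_snd_properInflexionPairs hf)
  rw [h.snd_image_properInflexionPairs hf hgen hne]
  exact (h.finite_parallelPoints hf hgen hne hfin).sdiff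

/-- Mixed pairs correspond, by their second point, to the parallel points that are not inflexions.
Finiteness matters because `ncard` of an infinite set is `0`. -/
theorem ncard_properInflexionPairs (hne : (inflexionParams f).Nonempty)
    (hfin : (inflexionParams f).Finite) :
    (properInflexionPairs f).ncard + (inflexionParams f).ncard = (parallelPoints f).ncard := by
  rw [← (hgen.injOn_snd_properInflexionPairs hf).ncard_image,
    h.snd_image_properInflexionPairs hf hgen hne]
  exact ncard_sdiff_add_ncard_of_subset (h.inflexionParams_subset_parallelPoints hf hgen hne)
    (h.finite_parallelPoints hf hgen hne hfin)

theorem branchInflexions_half : branchInflexions f (1 / 2) =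
    properInflexionPairs f ∪ Prod.swap '' properInflexionPairs f := by
  ext ⟨s, t⟩
  rw [mem_union, mem_swap_image_properInflexionPairs]
  simp only [branchInflexions, mem_ofPred_eq, h.branchInflexionAt_iff hf hgen,
    mem_properInflexionPairs, h.inflexionParams_eq hgen, Prod.fst_swap, Prod.snd_swap,
    planeDet_swap (deriv f t) (deriv f s), neg_eq_zero]
  norm_num
  tauto

theorem branchInflexions_eq {lam : ℝ} (h0 : lam ≠ 0) (h2 : lam ≠ 1 / 2) (h1 : lam ≠ 1) :
    branchInflexions f lam = (properInflexionPairs f ∪ Prod.swap '' properInflexionPairs f) ∪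
      (fun s => (s, s)) '' inflexionParams f := by
  ext ⟨s, t⟩
  have hdiag : (s, t) ∈ (fun s => (s, s)) '' inflexionParams f ↔
      (s ∈ Ico (0 : ℝ) 1 ∧ t ∈ Ico (0 : ℝ) 1 ∧ planeDet (deriv f s) (deriv f t) = 0 ∧
        deriv (velocityAngle L) s = 0 ∧ deriv (velocityAngle L) t = 0) := by
    constructor
    · rintro ⟨u, hu, he⟩
      obtain ⟨rfl, rfl⟩ := Prod.mk.inj he
      rw [h.inflexionParams_eq hgen] at hu
      exact ⟨hu.1, hu.1, by rw [planeDet]; ring, hu.2, hu.2⟩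
    · rintro ⟨hs, ht, hD, hs', ht'⟩
      have e := h.inflexionParams_eq hgen
      have hs1 : s ∈ inflexionParams f := by rw [e]; exact ⟨hs, hs'⟩
      have ht1 : t ∈ inflexionParams f := by rw [e]; exact ⟨ht, ht'⟩
      exact ⟨s, hs1, by rw [hgen.eq_of_planeDet_eq_zero hs1 ht1 hD]⟩
  rw [mem_union, mem_union, hdiag, mem_swap_image_properInflexionPairs]
  simp only [branchInflexions, mem_ofPred_eq, h.branchInflexionAt_iff hf hgen,
    mem_properInflexionPairs, h.inflexionParams_eq hgen, Prod.fst_swap, Prod.snd_swap,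
    planeDet_swap (deriv f t) (deriv f s), neg_eq_zero]
  tauto

omit h hf hgen in
theorem _root_.wignerBranchInflexions_eq (hb : branchInflexions f (1 / 2) =
    properInflexionPairs f ∪ Prod.swap '' properInflexionPairs f) : wignerBranchInflexions f =
      (fun x : ℝ × ℝ => s(x.1, x.2)) '' properInflexionPairs f := by
  rw [wignerBranchInflexions, hb, image_union, image_image]
  simp only [Prod.fst_swap, Prod.snd_swap, Sym2.eq_swap, union_eq_left]
  rintro _ ⟨x, hx, rfl⟩
  exact ⟨x, hx, by simp⟩

-- A mixed pair and its swap cannot both be mixed pairs, so forgetting the order loses nothing.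
omit h hf hgen in
theorem _root_.injOn_sym2_properInflexionPairs (f : ℝ → ℂ) :
    InjOn (fun x : ℝ × ℝ => s(x.1, x.2)) (properInflexionPairs f) := by
  rintro ⟨s, t⟩ hx ⟨s', t'⟩ hy he
  rcases Sym2.eq_iff.1 he with ⟨h1, h2⟩ | ⟨h1, h2⟩
  · exact Prod.ext h1 h2
  · simp only [] at h1 h2
    subst h1 h2
    exact absurd hy.1 hx.2.2.1

theorem ncard_branchInflexions {lam : ℝ} (h0 : lam ≠ 0) (h2 : lam ≠ 1 / 2) (h1 : lam ≠ 1)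
    (hne : (inflexionParams f).Nonempty) (hfin : (inflexionParams f).Finite) :
    (branchInflexions f lam).Finite ∧ (branchInflexions f lam).ncard =
      2 * (properInflexionPairs f).ncard + (inflexionParams f).ncard := by
  have hA := h.finite_properInflexionPairs hf hgen hne hfin
  rw [h.branchInflexions_eq hf hgen h0 h2 h1]
  have hU := hA.union (hA.image Prod.swap)
  have hI := hfin.image fun s => (s, s)
  refine ⟨hU.union hI, ?_⟩
  have hdisj : Disjoint (properInflexionPairs f ∪ Prod.swap '' properInflexionPairs f)
      ((fun s => (s, s)) '' inflexionParams f) := by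
    rw [Set.disjoint_right]
    rintro _ ⟨s, hs, rfl⟩ (hx | hx)
    · exact hx.2.2.1 hs
    · rw [mem_swap_image_properInflexionPairs] at hx
      exact hx.2.2.1 hs
  rw [ncard_union_eq hdisj hU hI,
    ncard_union_eq (properInflexionPairs_disjoint_swap f) hA (hA.image _),
    ncard_image_of_injective _ Prod.swap_injective,
    ncard_image_of_injective _ fun a b hab => (Prod.mk.inj hab).1]
  ring

/-! ### Inflexions as points of the plane. -/

theorem fract_branchInflexionAt {lam s t : ℝ} (H : BranchInflexionAt f lam (s, t)) :
    (Int.fract s, Int.fract t) ∈ branchInflexions f lam := by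
  refine ⟨fract_mem_Ico s, fract_mem_Ico t, ?_⟩
  rw [h.branchInflexionAt_iff hf hgen] at H ⊢
  rwa [hf.periodic.deriv_of_real.fract, hf.periodic.deriv_of_real.fract,
    (h.periodic_deriv_angle hf).fract, (h.periodic_deriv_angle hf).fract]

omit h hgen in
theorem _root_.pointMap_mem_equidistant {lam : ℝ} {x : ℝ × ℝ} (hx : x ∈ closedParallelPairs f) :
    pointMap f lam x ∈ equidistant f lam := by
  have hc : Continuous (pointMap f lam) := by
    have := hf.differentiable.continuous
    unfold pointMap
    fun_prop
  exact (show MapsTo (pointMap f lam) {x | IsParallelPair f x.1 x.2}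
    {p | ∃ s t, IsParallelPair f s t ∧ p = pointMap f lam (s, t)} from
      fun x hx => ⟨x.1, x.2, hx, rfl⟩).closure hc hx

omit h hf hgen in
theorem _root_.BranchInflexionAt.mem_closedParallelPairs {lam : ℝ} {x : ℝ × ℝ}
    (H : BranchInflexionAt f lam x) : x ∈ closedParallelPairs f := by
  obtain ⟨ε, c, hε, -, rfl, hmem, -⟩ := H
  exact hmem 0 ⟨by linarith, hε⟩

theorem inflexionPoints_eq_image (lam : ℝ) :
    inflexionPoints f lam = pointMap f lam '' branchInflexions f lam := by
  ext p
  constructor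
  · rintro ⟨-, ⟨s, t⟩, hx, rfl⟩
    refine ⟨_, h.fract_branchInflexionAt hf hgen hx, ?_⟩
    simp only [pointMap, hf.periodic.fract]
  · rintro ⟨x, hx, rfl⟩
    exact ⟨pointMap_mem_equidistant hf hx.2.2.mem_closedParallelPairs, x, hx.2.2, rfl⟩

theorem isInflexionPair_of_mem_branchInflexions {lam : ℝ} {x : ℝ × ℝ}
    (hx : x ∈ branchInflexions f lam) : IsInflexionPair f x := by
  obtain ⟨h1, h2, H⟩ := hx
  rw [h.branchInflexionAt_iff hf hgen] at H
  refine ⟨h1, h2, H.1, ?_⟩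
  rw [h.inflexionParams_eq hgen]
  rcases H.2 with H | H | H
  · exact .inl ⟨h1, H.1⟩
  · exact .inr ⟨h2, H.2.1⟩
  · exact .inl ⟨h1, H.1⟩

theorem injOn_pointMap (hch : ChordsInGeneralPosition f) {lam : ℝ} (h0 : lam ≠ 0)
    (h2 : lam ≠ 1 / 2) (h1 : lam ≠ 1) : InjOn (pointMap f lam) (branchInflexions f lam) :=
  fun x hx y hy hxy => (hch lam h0 h1 x y (h.isInflexionPair_of_mem_branchInflexions hf hgen hx)
    (h.isInflexionPair_of_mem_branchInflexions hf hgen hy) hxy).resolve_right fun H => h2 H.1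

omit h hf hgen in
theorem _root_.pointMap_half_swap (f : ℝ → ℂ) (x : ℝ × ℝ) :
    pointMap f (1 / 2) x.swap = pointMap f (1 / 2) x := by
  simp only [pointMap, Prod.fst_swap, Prod.snd_swap]
  norm_num
  ring

theorem inflexionPoints_half_eq_image :
    inflexionPoints f (1 / 2) = pointMap f (1 / 2) '' properInflexionPairs f := by
  rw [h.inflexionPoints_eq_image hf hgen, h.branchInflexions_half hf hgen, image_union,
    image_image]
  simp only [pointMap_half_swap, union_self]

theorem injOn_pointMap_half (hch : ChordsInGeneralPosition f) :
    InjOn (pointMap f (1 / 2)) (properInflexionPairs f) := by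
  intro x hx y hy hxy
  have hsub : ∀ z ∈ properInflexionPairs f, z ∈ branchInflexions f (1 / 2) := fun z hz => by
    rw [h.branchInflexions_half hf hgen]
    exact .inl hz
  rcases hch _ (by norm_num) (by norm_num) x y
    (h.isInflexionPair_of_mem_branchInflexions hf hgen (hsub x hx))
    (h.isInflexionPair_of_mem_branchInflexions hf hgen (hsub y hy)) hxy with H | ⟨-, rfl⟩
  · exact H
  · exact absurd hy.1 hx.2.2.1

theorem iUnion_inflexionPoints : (⋃ lam : ℝ, inflexionPoints f lam) =
    {p | ∃ s t, IsParallelPair f s t ∧ HasInflexionAt f s ∧ p ∈ chord (f s) (f t) \ {f t}} := by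
  ext p
  rw [mem_iUnion]
  constructor
  · rintro ⟨lam, -, ⟨s, t⟩, hx, rfl⟩
    have hb := (h.branchInflexionAt_iff hf hgen _ _ _).1 hx
    have key : ∀ (mu a b : ℝ), planeDet (deriv f a) (deriv f b) = 0 →
        deriv (velocityAngle L) a = 0 → deriv (velocityAngle L) b ≠ 0 → mu ≠ 0 →
        IsParallelPair f a b ∧ HasInflexionAt f a ∧
          pointMap f mu (a, b) ∈ chord (f a) (f b) \ {f b} := by
      intro mu a b hD ha hb hmu
      have hpair : IsParallelPair f a b := hgen.isParallelPair hf hD fun k hk => hb (by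
        rw [hk, (h.periodic_deriv_angle hf).add_intCast, ha])
      refine ⟨hpair, (h.hasInflexionAt_iff hgen a).2 ha, ⟨mu, rfl⟩, fun H => ?_⟩
      have H : pointMap f mu (a, b) = f b := H
      have : (mu : ℂ) * (f a - f b) = 0 := by
        simp only [pointMap] at H
        push_cast at H
        linear_combination H
      exact (mul_ne_zero (Complex.ofReal_ne_zero.2 hmu) (sub_ne_zero.2 hpair.1)) this
    obtain ⟨hD, ⟨hs, ht, hl⟩ | ⟨hs, ht, hl⟩ | ⟨hs, ht, -⟩⟩ := hb
    · exact ⟨s, t, key lam s t hD hs ht hl⟩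
    · rw [planeDet_swap, neg_eq_zero] at hD
      have := key (1 - lam) t s hD ht hs (sub_ne_zero.2 hl.symm)
      have e : pointMap f (1 - lam) (t, s) = pointMap f lam (s, t) := by
        simp only [pointMap]; push_cast; ring
      rw [e] at this
      exact ⟨t, s, this⟩
    -- A diagonal pair contributes the inflexion `f s` itself, which lies on the chord to any
    -- parallel partner with ratio `1`.
    · obtain ⟨k, rfl⟩ := h.exists_int_of_inflexions hf hgen hD hs ht
      obtain ⟨t, hpair⟩ := hgen.exists_isParallelPair hf s
      have e : pointMap f lam (s, s + k) = f s := by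
        simp only [pointMap, hf.periodic.add_intCast]; push_cast; ring
      rw [e]
      exact ⟨s, t, hpair, (h.hasInflexionAt_iff hgen s).2 hs, ⟨1, by simp⟩, hpair.1⟩
  · rintro ⟨s, t, hpair, hs, ⟨r, rfl⟩, hne⟩
    rw [h.hasInflexionAt_iff hgen] at hs
    have hr : r ≠ 0 := by
      rintro rfl
      exact hne (by simp)
    refine ⟨r, pointMap_mem_equidistant hf hpair.mem_closedParallelPairs, (s, t), ?_, rfl⟩
    refine h.branchInflexionAt_of_ne_zero hf hgen hpair.2 hs (fun ht => ?_) hr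
    obtain ⟨k, rfl⟩ := h.exists_int_of_inflexions hf hgen hpair.2 hs ht
    exact hpair.1 (hf.periodic.add_intCast s k).symm

end IsLogVelocity
end
-- The final count.
theorem corollary5p5 (f : ℝ → ℂ) (hf : IsRegularClosedCurve f) (hgen : IsGenericCurve f)
    (n m : ℕ) (hn : 0 < n) (hinfl : (inflexionParams f).ncard = 2 * n)
    (hpar : (parallelPoints f).ncard = 2 * m) :
    -- the Wigner caustic
    ((wignerBranchInflexions f).Finite ∧
      ((wignerBranchInflexions f).ncard : ℤ) = 2 * (m : ℤ) - 2 * (n : ℤ)) ∧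
    -- the other equidistants
    (∀ lam : ℝ, lam ≠ 0 → lam ≠ 1 / 2 → lam ≠ 1 →
      (branchInflexions f lam).Finite ∧
      ((branchInflexions f lam).ncard : ℤ) = 4 * (m : ℤ) - 2 * (n : ℤ)) ∧
    -- in general position the same numbers count points of the plane
    (ChordsInGeneralPosition f →
      ((inflexionPoints f (1 / 2)).Finite ∧
        ((inflexionPoints f (1 / 2)).ncard : ℤ) = 2 * (m : ℤ) - 2 * (n : ℤ)) ∧
      (∀ lam : ℝ, lam ≠ 0 → lam ≠ 1 / 2 → lam ≠ 1 →
        (inflexionPoints f lam).Finite ∧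
        ((inflexionPoints f lam).ncard : ℤ) = 4 * (m : ℤ) - 2 * (n : ℤ))) ∧
    -- all inflexion points of all equidistants
    (⋃ lam : ℝ, inflexionPoints f lam) =
      {p | ∃ s t, IsParallelPair f s t ∧ HasInflexionAt f s ∧ p ∈ chord (f s) (f t) \ {f t}} := by
  obtain ⟨L, h⟩ := hf.exists_isLogVelocity
  have hpos : 0 < (inflexionParams f).ncard := by omega
  have hfin : (inflexionParams f).Finite := finite_of_ncard_pos hpos
  have hne : (inflexionParams f).Nonempty := nonempty_of_ncard_ne_zero hpos.ne'
  have hA := h.finite_properInflexionPairs hf hgen hne hfin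
  have hcard := h.ncard_properInflexionPairs hf hgen hne hfin
  have hother : ∀ lam : ℝ, lam ≠ 0 → lam ≠ 1 / 2 → lam ≠ 1 → (branchInflexions f lam).Finite ∧
      ((branchInflexions f lam).ncard : ℤ) = 4 * (m : ℤ) - 2 * (n : ℤ) := by
    intro lam h0 h2 h1
    obtain ⟨hB, hB'⟩ := h.ncard_branchInflexions hf hgen h0 h2 h1 hne hfin
    -- The count is `2(2m - 2n) + 2n`, from `hcard` and `hB'`.
    exact ⟨hB, by omega⟩
  refine ⟨?_, hother, fun hch => ⟨?_, fun lam h0 h2 h1 => ?_⟩, h.iUnion_inflexionPoints hf hgen⟩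
  · rw [wignerBranchInflexions_eq (h.branchInflexions_half hf hgen),
      (injOn_sym2_properInflexionPairs f).ncard_image]
    exact ⟨hA.image _, by omega⟩
  · rw [h.inflexionPoints_half_eq_image hf hgen,
      (h.injOn_pointMap_half hf hgen hch).ncard_image]
    exact ⟨hA.image _, by omega⟩
  · rw [h.inflexionPoints_eq_image hf hgen,
      (h.injOn_pointMap hf hgen hch h0 h2 h1).ncard_image]
    exact ⟨(hother lam h0 h2 h1).1.image _, (hother lam h0 h2 h1).2⟩
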